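/- Let $\mathbb D=\{z\in\mathbb C:|z|<1\}$. A convex function is here an analytic, univalent function $g$ on $\mathbb D$ with $g(\mathbb D)$ convex, $g(0)=0$ and $\operatorname{Re} g'(0)>0$. Let $\mathcal C_3$ be the class of analytic functions $f$ on $\mathbb D$ for which there is a convex function $g$ with $$\operatorname{Re}\left(\frac{\bigl(z(zf'(z))'\bigr)'}{(zg'(z))'}\right)>0\qquad(z\in\mathbb D).$$ Write $d(f(0),\partial f(\mathbb D))$ for the Euclidean distance from $f(0)$ to the boundary of $f(\mathbb D)$. **Theorem.** Let $N\ge 1$ be an integer. The equation $$\left(\frac{2r}{3(1-r)}-\frac13\int_0^r\frac{\log(1-t)}{t}\,dt\right)^2+\sum_{n=N}^\infty\frac{r^n}{3n^2}+\frac{24r^N+(12+\pi^2)r-12-\pi^2}{36(1-r)}=0$$ has exactly one root $R_{2,N}$ in $(0,1/2)$. For every $f(z)=z+\sum_{n\ge2}a_nz^n\in\mathcal C_3$ (with $a_1=1$), $$|f(z)|^2+\sum_{n=N}^\infty|a_nz^n|\le d(f(0),\partial f(\mathbb D))\qquad\text{for } |z|\le R_{2,N}.$$ The radius $R_{2,N}$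 is sharp: the function $$f_0(z)=\frac{2z}{3(1-z)}-\frac13\int_0^z\frac{\log(1-\zeta)}{\zeta}\,d\zeta$$ belongs to $\mathcal C_3$, satisfies $f_0(0)=0$ and $f_0'(0)=1$, gives equality in the inequality at $z=R_{2,N}$, and violates the inequality at $z=r$ for every $r\in(R_{2,N},1)$. -/

import Mathlib

open Metric

noncomputable section

namespace BohrRogosinski

/-- The open unit disc. -/
def disc : Set ℂ := ball 0 1

/-- A convex function `g(z) = b₁ z + ⋯` with `Re b₁ > 0`: analytic and univalent in the disc, with
convex image. -/
structure IsConvexFunction (g : ℂ → ℂ) : Prop where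
  analytic : DifferentiableOn ℂ g disc
  univalent : Set.InjOn g disc
  convex_image : Convex ℝ (g '' disc)
  map_zero : g 0 = 0
  re_deriv_zero_pos : 0 < (deriv g 0).re

/-- The operator `h ↦ z h'`. -/
def zDeriv (h : ℂ → ℂ) : ℂ → ℂ := fun z => z * deriv h z

/-- The class `𝒞₃`: analytic functions `f` on the disc such that, for some convex function `g`,
`Re ((z (z f')')' / (z g')') > 0` at every point of the disc. -/
structure IsClassC3 (f : ℂ → ℂ) : Prop where
  analytic : DifferentiableOn ℂ f disc
  exists_convex : ∃ g : ℂ → ℂ, IsConvexFunction g ∧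
    ∀ z ∈ disc, 0 < (deriv (zDeriv (zDeriv f)) z / deriv (zDeriv g) z).re

/-- The `n`-th Taylor coefficient at the origin. -/
def taylorCoeff (f : ℂ → ℂ) (n : ℕ) : ℂ := iteratedDeriv n f 0 / (n.factorial : ℂ)

/-- `|f(z)|² + ∑_{n ≥ N} |aₙ zⁿ|`. -/
def bohrSum (N : ℕ) (f : ℂ → ℂ) (z : ℂ) : ℝ :=
  ‖f z‖ ^ 2 + ∑' k : ℕ, ‖taylorCoeff f (N + k) * z ^ (N + k)‖

/-- The Euclidean distance `d(f(0), ∂f(𝔻))`. -/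
def boundaryDist (f : ℂ → ℂ) : ℝ := infDist (f 0) (frontier (f '' disc))

/-- The left-hand side of the equation that determines the radius. -/
def radiusEq (N : ℕ) (r : ℝ) : ℝ :=
  (2 * r / (3 * (1 - r)) - 1 / 3 * ∫ t in (0 : ℝ)..r, Real.log (1 - t) / t) ^ 2
    + ∑' k : ℕ, r ^ (N + k) / (3 * ((N + k : ℕ) : ℝ) ^ 2)
    + (24 * r ^ N + (12 + Real.pi ^ 2) * r - 12 - Real.pi ^ 2) / (36 * (1 - r))

/-- The function `2z / (3(1 - z)) - (1/3) ∫₀ᶻ log(1 - ζ)/ζ dζ`, with the integral taken along the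
segment `ζ = t z`, `0 ≤ t ≤ 1`, so that `dζ/ζ = dt/t`. -/
def extremal (z : ℂ) : ℂ :=
  2 * z / (3 * (1 - z)) - 1 / 3 * ∫ t in (0 : ℝ)..1, Complex.log (1 - (t : ℂ) * z) / (t : ℂ)

end BohrRogosinski

end

/-! Both sides of the inequality are compared with `extremal`, that is f₀. Its Taylor coefficients
2/3 + 1/(3n²) are positive, and -f₀(-r) tends to ρ = (12 + π²)/36 (`coveringRadius`) as r → 1. It
suffices to show, for f in the class with auxiliary convex g, that |aₙ| ≤ 2/3 + 1/(3n²) and that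
d(f(0), ∂f(𝔻)) ≥ ρ. The left side is then at most f₀(r)² plus the tail of f₀ at r = |z|. Subtracting
ρ from this gives exactly `radiusEq`, which is strictly increasing on [0, 1), negative at 0 and
positive at 1/2. Its root is therefore unique, and f₀ attains equality throughout.

The coefficient bound (`IsC3Pair.norm_taylorCoeff_le`) compares coefficients in (z(zf')')' = p ·
(zg')', where Re p > 0. It combines Carathéodory's bound for p with |bₙ| ≤ |b₁| for the coefficients
bₙ of g.

The covering bound needs a lower growth estimate at three levels: z(zf')', then zf', then f. The
first level integrates a bound for (z(zf')')'/(zg')' along preimages of rays under the starlike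
function zg' (`le_re_div_mul_norm`). The other two integrate a lower bound for the derivative along
the lift of a segment (`le_norm_of_le_norm_deriv`), which requires zf' and f to be univalent. The
function zf' is close-to-convex with respect to g. Univalence of f is subtler (`IsC3Pair.injOn`):
starlikeness is passed from g(w) - g(xw) to G(w) - G(xw), where G = ∫ g/z, and then f(w) - f(xw) is
compared with the latter.

Since g'(0) is only assumed to have positive real part, the sharp pointwise growth bound is not
obtained directly. The estimates carry an error term `defect g` · (r - 4r³), whose weight is chosen
so that after the two further integrations it becomes (r² - r⁴)/4, which vanishes at r = 1. The
limit ρ is thus unaffected by the argument of g'(0). -/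

noncomputable section

namespace BohrRogosinski

open Complex Filter Topology Set

/-! ### Univalent functions and their inverses -/

/-- An injective holomorphic function has nonvanishing derivative. -/
theorem deriv_ne_zero_of_injOn {U : Set ℂ} (hU : IsOpen U) {g : ℂ → ℂ}
    (hg : DifferentiableOn ℂ g U) (hinj : InjOn g U) {z : ℂ} (hz : z ∈ U) : deriv g z ≠ 0 := by
  intro h0
  have hUz : U ∈ 𝓝 z := hU.mem_nhds hz
  have han : AnalyticAt ℂ g z := hg.analyticAt hUz
  set F : ℂ → ℂ := fun w => g w - g z with hF
  have hFan : AnalyticAt ℂ F z := han.sub analyticAt_const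
  have hne : analyticOrderAt F z ≠ ⊤ := by
    intro htop
    rw [analyticOrderAt_eq_top] at htop
    have h1 : ∀ᶠ w in 𝓝 z, w = z := by
      filter_upwards [htop, hUz] with w hw hwU
      exact hinj hwU hz (sub_eq_zero.1 hw)
    have h2 : ∀ᶠ w in 𝓝[≠] z, w = z := h1.filter_mono nhdsWithin_le_nhds
    have h3 : ∀ᶠ w in 𝓝[≠] z, w ≠ z := eventually_mem_nhdsWithin
    obtain ⟨w, hw1, hw2⟩ := (h2.and h3).exists
    exact hw2 hw1
  obtain ⟨n, hn⟩ := ENat.ne_top_iff_exists.1 hne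
  obtain ⟨k, hk, hk0, hFk⟩ := (hFan.analyticOrderAt_eq_natCast (n := n)).1 hn.symm
  have hn0 : n ≠ 0 := by
    rintro rfl
    have := hFk.self_of_nhds
    simp [hF] at this
    exact hk0 this.symm
  have hn1 : n ≠ 1 := by
    rintro rfl
    have h1 : HasDerivAt F (k z) z := by
      have h2 : HasDerivAt (fun w => (w - z) * k w) (1 * k z + (z - z) * deriv k z) z :=
        ((hasDerivAt_id z).sub_const z).mul hk.differentiableAt.hasDerivAt
      simp only [one_mul, sub_self, zero_mul, add_zero] at h2
      refine h2.congr_of_eventuallyEq ?_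
      filter_upwards [hFk] with w hw
      simpa using hw
    have h3 : HasDerivAt F (deriv g z) z := (han.differentiableAt.hasDerivAt).sub_const _
    exact hk0 (h1.unique h3 |>.trans h0)
  have hn2 : 2 ≤ n := by omega
  obtain ⟨c, hc⟩ := IsAlgClosed.exists_pow_nat_eq (k z) (Nat.pos_of_ne_zero hn0)
  have hc0 : c ≠ 0 := by
    rintro rfl
    exact hk0 (by rw [← hc, zero_pow hn0])
  -- A holomorphic n-th root of k near z. Normalizing by k(z) keeps the logarithm near 1, away from
  -- the branch cut. Then F = ψⁿ with ψ locally invertible.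
  set l : ℂ → ℂ := fun w => c * exp (log (k w / k z) / n) with hl
  have hlan : AnalyticAt ℂ l z := by
    refine analyticAt_const.mul (AnalyticAt.cexp ?_)
    refine AnalyticAt.div_const ?_
    refine AnalyticAt.clog (hk.div_const) ?_
    rw [div_self hk0]; exact one_mem_slitPlane
  have hlz : l z = c := by simp [hl, div_self hk0]
  set ψ : ℂ → ℂ := fun w => (w - z) * l w with hψ
  have hψan : AnalyticAt ℂ ψ z := (analyticAt_id.sub analyticAt_const).mul hlan
  have hψd : HasDerivAt ψ c z := by
    have h2 : HasDerivAt ψ (1 * l z + (z - z) * deriv l z) z :=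
        ((hasDerivAt_id z).sub_const z).mul hlan.differentiableAt.hasDerivAt
    simpa [hlz] using h2
  have hmap : map ψ (𝓝 z) = 𝓝 0 := by
    have h1 := hψan.hasStrictDerivAt
    rw [hψd.deriv] at h1
    have := h1.map_nhds_eq hc0
    simpa [hψ] using this
  have hFψ : ∀ᶠ w in 𝓝 z, F w = ψ w ^ n := by
    have hkne : ∀ᶠ w in 𝓝 z, k w ≠ 0 := hk.continuousAt.eventually_ne hk0
    filter_upwards [hFk, hkne] with w hw hkw
    have hn' : (n : ℂ) ≠ 0 := by exact_mod_cast hn0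
    have : l w ^ n = k w := by
      rw [hl]
      simp only [mul_pow]
      rw [← Complex.exp_nat_mul, mul_div_cancel₀ _ hn', Complex.exp_log (div_ne_zero hkw hk0), hc,
        mul_div_cancel₀ _ hk0]
    rw [hw, hψ]
    simp only [mul_pow, this, smul_eq_mul]
  have himg : ψ '' (U ∩ {w | F w = ψ w ^ n}) ∈ 𝓝 (0 : ℂ) := by
    rw [← hmap]
    exact image_mem_map (inter_mem hUz hFψ)
  obtain ⟨ε, hε, hball⟩ := Metric.mem_nhds_iff.1 himg
  -- Since n ≥ 2, ψ takes the two distinct values ε/2 and ζε/2, whose n-th powers agree. This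
  -- contradicts injectivity.
  obtain ⟨ζ, hζ⟩ : ∃ ζ : ℂ, IsPrimitiveRoot ζ n := ⟨_, Complex.isPrimitiveRoot_exp n hn0⟩
  have hζn : ‖ζ‖ = 1 := hζ.norm'_eq_one hn0
  have hζ1 : ζ ≠ 1 := hζ.ne_one (by omega)
  have hε2 : ((ε / 2 : ℝ) : ℂ) ≠ 0 := by exact_mod_cast (half_pos hε).ne'
  obtain ⟨w₁, ⟨hw₁U, hw₁⟩, hw₁'⟩ := hball (show ((ε / 2 : ℝ) : ℂ) ∈ ball 0 ε by
    rw [mem_ball_zero_iff, norm_real, Real.norm_of_nonneg (half_pos hε).le]; linarith)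
  obtain ⟨w₂, ⟨hw₂U, hw₂⟩, hw₂'⟩ := hball (show ζ * ((ε / 2 : ℝ) : ℂ) ∈ ball 0 ε by
    rw [mem_ball_zero_iff, norm_mul, hζn, norm_real, Real.norm_of_nonneg (half_pos hε).le]
    linarith)
  have hF12 : F w₁ = F w₂ := by
    rw [mem_ofPred_eq] at hw₁ hw₂
    rw [hw₁, hw₂, hw₁', hw₂', mul_pow, hζ.pow_eq_one, one_mul]
  have hw : w₁ = w₂ := hinj hw₁U hw₂U (by simpa [hF] using hF12)
  rw [hw, hw₂'] at hw₁'
  exact hζ1 (mul_right_cancel₀ hε2 (by rw [hw₁', one_mul]))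

/-- `invFunOn` is a choice of preimages. Near g(z) injectivity forces it to agree with the local
inverse given by the inverse function theorem. -/
theorem hasDerivAt_invFunOn {U : Set ℂ} (hU : IsOpen U) {g : ℂ → ℂ}
    (hg : DifferentiableOn ℂ g U) (hinj : InjOn g U) {z : ℂ} (hz : z ∈ U) :
    HasDerivAt (Function.invFunOn g U) (deriv g z)⁻¹ (g z) := by
  have hne := deriv_ne_zero_of_injOn hU hg hinj hz
  have han : AnalyticAt ℂ g z := hg.analyticAt (hU.mem_nhds hz)
  have hs := han.hasStrictDerivAt
  have hL := hs.to_localInverse hne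
  refine hL.hasDerivAt.congr_of_eventuallyEq ?_
  have h1 : ∀ᶠ w in 𝓝 (g z), g (hs.localInverse g _ z hne w) = w := by
    rw [← hs.map_nhds_eq hne, eventually_map]
    exact (HasStrictFDerivAt.eventually_left_inverse
      (hs.hasStrictFDerivAt_equiv hne)).mono fun x hx => by
        rw [HasStrictDerivAt.localInverse, hx]
  have h0 : hs.localInverse g _ z hne (g z) = z :=
    HasStrictFDerivAt.localInverse_apply_image (hs.hasStrictFDerivAt_equiv hne)
  have h2 : ∀ᶠ w in 𝓝 (g z), hs.localInverse g _ z hne w ∈ U := by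
    have hc := hL.hasDerivAt.continuousAt
    refine hc.eventually_mem ?_
    rw [h0]; exact hU.mem_nhds hz
  filter_upwards [h1, h2] with w hw1 hw2
  have hmem : w ∈ g '' U := ⟨_, hw2, hw1⟩
  refine hinj (Function.invFunOn_mem hmem) hw2 ?_
  rw [Function.invFunOn_eq hmem, hw1]

/-! ### The disc, subordination and minimum principles -/

theorem isOpen_disc : IsOpen disc := isOpen_ball

theorem mem_disc {z : ℂ} : z ∈ disc ↔ ‖z‖ < 1 := by simp [disc]

theorem zero_mem_disc : (0 : ℂ) ∈ disc := by simp [disc]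

theorem disc_mem_nhds {z : ℂ} (hz : z ∈ disc) : disc ∈ 𝓝 z := isOpen_disc.mem_nhds hz

theorem isPreconnected_disc : IsPreconnected disc := (convex_ball _ _).isPreconnected

theorem mul_mem_disc {x z : ℂ} (hx : ‖x‖ ≤ 1) (hz : z ∈ disc) : x * z ∈ disc := by
  rw [mem_disc] at *
  rw [norm_mul]
  nlinarith [norm_nonneg x, norm_nonneg z]

theorem closedBall_subset_disc {r : ℝ} (hr : r < 1) : closedBall (0 : ℂ) r ⊆ disc :=
  closedBall_subset_ball hr

/-- Subordination: a function with values in the image of the univalent function `g` and vanishing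
at the origin factors through a self-map of the disc that satisfies Schwarz's lemma. -/
theorem norm_invFunOn_comp_le {g u : ℂ → ℂ} (hg : DifferentiableOn ℂ g disc)
    (hinj : InjOn g disc) (hg0 : g 0 = 0) (hu : DifferentiableOn ℂ u disc)
    (hmaps : MapsTo u disc (g '' disc)) (hu0 : u 0 = 0) {z : ℂ} (hz : z ∈ disc) :
    ‖Function.invFunOn g disc (u z)‖ ≤ ‖z‖ := by
  have hd : DifferentiableOn ℂ (fun w => Function.invFunOn g disc (u w)) (ball 0 1) := by
    intro w hw
    obtain ⟨y, hy, hyw⟩ := hmaps hw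
    have h1 := hasDerivAt_invFunOn isOpen_disc hg hinj hy
    rw [hyw] at h1
    exact h1.differentiableAt.comp_differentiableWithinAt w (hu w hw)
  refine norm_le_norm_of_mapsTo_ball hd (fun w hw => ?_) ?_ (mem_disc.1 hz)
  · exact ball_subset_closedBall (Function.invFunOn_mem (hmaps hw))
  · have h0 : (0 : ℂ) ∈ g '' disc := ⟨0, zero_mem_disc, hg0⟩
    refine hinj (Function.invFunOn_mem (by rw [hu0]; exact h0)) zero_mem_disc ?_
    rw [hu0, Function.invFunOn_eq h0, hg0]

/-- A holomorphic function with nonnegative real part, positive at one point, has positive real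
part. -/
theorem re_pos_of_re_nonneg {U : Set ℂ} (hU : IsOpen U) (hc : IsPreconnected U) {k : ℂ → ℂ}
    (hk : DifferentiableOn ℂ k U) (hnn : ∀ z ∈ U, 0 ≤ (k z).re) {w : ℂ} (hw : w ∈ U)
    (hpos : 0 < (k w).re) {z : ℂ} (hz : z ∈ U) : 0 < (k z).re := by
  rcases (hnn z hz).lt_or_eq with h | h
  · exact h
  exfalso
  -- |exp(-k)| = exp(-Re k), so a zero of Re k is a maximum of the modulus, and the maximum
  -- principle applies.
  have hd : DifferentiableOn ℂ (fun y => exp (-k y)) U := hk.neg.cexp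
  have hmax : IsMaxOn (norm ∘ fun y => exp (-k y)) U z := by
    intro y hy
    simp only [Function.comp, norm_exp, neg_re, mem_ofPred_eq, ← h, Real.exp_le_exp]
    linarith [hnn y hy]
  have := norm_eqOn_of_isPreconnected_of_isMaxOn hc hU hd hz hmax hw
  simp only [Function.comp, Function.const_apply, norm_exp, neg_re, ← h] at this
  have h2 := Real.exp_injective this
  linarith

/-- The minimum principle for the real part on a disc. -/
theorem re_nonneg_of_sphere {k : ℂ → ℂ} {ρ : ℝ} (hρ : 0 < ρ)
    (hk : DifferentiableOn ℂ k (closedBall 0 ρ))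
    (hs : ∀ z ∈ sphere (0 : ℂ) ρ, 0 ≤ (k z).re) {z : ℂ} (hz : z ∈ closedBall (0 : ℂ) ρ) :
    0 ≤ (k z).re := by
  have hd : DiffContOnCl ℂ (fun y => exp (-k y)) (ball 0 ρ) := by
    refine DifferentiableOn.diffContOnCl ?_
    rw [closure_ball _ hρ.ne']
    exact hk.neg.cexp
  have := norm_le_of_forall_mem_frontier_norm_le isBounded_ball hd (C := 1)
    (by
      intro y hy
      rw [frontier_ball _ hρ.ne'] at hy
      rw [norm_exp, neg_re, Real.exp_le_one_iff]
      linarith [hs y hy]) (z := z) (by rwa [closure_ball _ hρ.ne'])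
  rw [norm_exp, neg_re, Real.exp_le_one_iff] at this
  linarith

/-! ### From bounds for F'/φ' to bounds for F/φ, with φ starlike -/

theorem hasDerivAt_norm_curve {c : ℝ → ℂ} {c' : ℂ} {t : ℝ} (h : HasDerivAt c c' t)
    (h0 : c t ≠ 0) : HasDerivAt (fun s => ‖c s‖) (‖c t‖ * (c' / c t).re) t := by
  have hn : 0 < ‖c t‖ := norm_pos_iff.2 h0
  have h1 := (h.norm_sq).sqrt (by positivity)
  have h2 : (fun s => √(‖c s‖ ^ 2)) = fun s => ‖c s‖ := by
    funext s; exact Real.sqrt_sq (norm_nonneg _)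
  rw [h2, Real.sqrt_sq hn.le] at h1
  refine h1.congr_deriv ?_
  rw [Complex.inner, div_re]
  have hq : normSq (c t) = ‖c t‖ ^ 2 := normSq_eq_norm_sq _
  simp only [mul_re, conj_re, conj_im]
  rw [hq]
  field_simp
  try ring

theorem eventually_lt_of_hasDerivAt_neg {f : ℝ → ℝ} {d : ℝ} (h : HasDerivAt f d 0) (hd : d < 0) :
    ∀ᶠ t in 𝓝[>] (0 : ℝ), f t < f 0 := by
  have h1 := h.tendsto_slope_zero_right.eventually (gt_mem_nhds hd)
  filter_upwards [h1, self_mem_nhdsWithin] with t ht ht0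
  have ht0 : (0 : ℝ) < t := ht0
  simp only [zero_add, smul_eq_mul] at ht
  have := (inv_mul_lt_iff₀ ht0).1 ht
  linarith

/-- A lower bound for `Re (e F / φ) |φ|`, where `φ` is starlike, obtained by integrating a lower
bound for `Re (e F' / φ')` along the preimages of the rays under `φ`. -/
theorem le_re_div_mul_norm {φ F : ℂ → ℂ} {e : ℂ} {R : ℝ} (hR1 : R < 1)
    (hφ : DifferentiableOn ℂ φ disc) (hF : DifferentiableOn ℂ F disc) (hφ0 : φ 0 = 0)
    (hF0 : F 0 = 0) (hst : ∀ z : ℂ, ‖z‖ ≤ R → z ≠ 0 → 0 < (φ z / (z * deriv φ z)).re)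
    {X Y : ℝ → ℝ} (hX0 : X 0 = 0) (hX : ∀ r, 0 < r → r ≤ R → HasDerivAt X (Y r) r)
    (hXc : ContinuousOn X (Icc 0 R))
    (hineq : ∀ z : ℂ, ‖z‖ ≤ R → z ≠ 0 → Y ‖z‖ * ‖z‖ * (φ z / (z * deriv φ z)).re ≤
      (e * deriv F z / deriv φ z).re * ‖φ z‖) {z : ℂ} (hz : ‖z‖ ≤ R) :
    X ‖z‖ ≤ (e * F z / φ z).re * ‖φ z‖ := by
  have hφne : ∀ z : ℂ, ‖z‖ ≤ R → z ≠ 0 → φ z ≠ 0 := by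
    intro w hw hw0 h
    have := hst w hw hw0
    simp [h] at this
  have hφ'ne : ∀ z : ℂ, ‖z‖ ≤ R → z ≠ 0 → deriv φ z ≠ 0 := by
    intro w hw hw0 h
    have := hst w hw hw0
    simp [h] at this
  have hsub : closedBall (0 : ℂ) R ⊆ disc := closedBall_subset_disc hR1
  by_contra hcon
  push Not at hcon
  -- The perturbation ε|φ| makes the derivative at a minimum strictly negative below. It is small
  -- enough to keep Ψ(z) < 0.
  set ε : ℝ := (X ‖z‖ - (e * F z / φ z).re * ‖φ z‖) / (2 * (‖φ z‖ + 1)) with hε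
  have hεpos : 0 < ε := div_pos (by linarith) (by positivity)
  set Ψ : ℂ → ℝ := fun w => (e * F w / φ w).re * ‖φ w‖ + ε * ‖φ w‖ - X ‖w‖ with hΨ
  have hΨz : Ψ z < 0 := by
    have h1 : ε * ‖φ z‖ < X ‖z‖ - (e * F z / φ z).re * ‖φ z‖ := by
      rw [hε, div_mul_eq_mul_div, div_lt_iff₀ (by positivity)]
      nlinarith [norm_nonneg (φ z)]
    simp only [hΨ]; linarith
  have hΨ0 : Ψ 0 = 0 := by simp [hΨ, hφ0, hX0]
  have hcont : ContinuousOn Ψ (closedBall 0 R) := by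
    have hφc : ContinuousOn φ (closedBall 0 R) := hφ.continuousOn.mono hsub
    have hFc : ContinuousOn F (closedBall 0 R) := hF.continuousOn.mono hsub
    have h1 : ContinuousOn (fun w : ℂ => X ‖w‖) (closedBall 0 R) :=
      hXc.comp continuous_norm.continuousOn fun w hw => ⟨norm_nonneg _, by simpa using hw⟩
    refine (ContinuousOn.add ?_ (continuousOn_const.mul hφc.norm)).sub h1
    intro w hw
    by_cases hw0 : w = 0
    · subst hw0
      have hlim : Tendsto (fun w => ‖e‖ * ‖F w‖) (𝓝[closedBall 0 R] 0) (𝓝 0) := by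
        have := (hFc 0 hw).norm.const_mul ‖e‖
        simpa [ContinuousWithinAt, hF0] using this
      rw [ContinuousWithinAt]
      simp only [hφ0, div_zero, zero_re, zero_mul]
      refine squeeze_zero_norm (fun w => ?_) hlim
      rw [norm_mul, norm_norm, ← norm_mul]
      by_cases hφw : φ w = 0
      · rw [hφw, norm_zero, mul_zero]; positivity
      · refine (mul_le_mul_of_nonneg_right (abs_re_le_norm _) (norm_nonneg _)).trans ?_
        rw [norm_div, div_mul_cancel₀ _ (norm_ne_zero_iff.2 hφw)]
    · have hw' : ‖w‖ ≤ R := by simpa using hw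
      have : ContinuousWithinAt (fun w => e * F w / φ w) (closedBall 0 R) w :=
        (continuousWithinAt_const.mul (hFc w hw)).div (hφc w hw) (hφne w hw' hw0)
      exact (continuous_re.continuousAt.comp_continuousWithinAt this).mul (hφc w hw).norm
  obtain ⟨z₁, hz₁, hmin⟩ := (isCompact_closedBall (0 : ℂ) R).exists_isMinOn
    ⟨z, by simpa using hz⟩ hcont
  have hz₁R : ‖z₁‖ ≤ R := by simpa using hz₁
  have hle : ∀ w : ℂ, ‖w‖ ≤ R → Ψ z₁ ≤ Ψ w := fun w hw => hmin (by simpa using hw)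
  have hz₁0 : z₁ ≠ 0 := by
    rintro rfl
    have := hle z hz
    linarith
  have hφz := hφne z₁ hz₁R hz₁0
  have hφ'z := hφ'ne z₁ hz₁R hz₁0
  have hzd := disc_mem_nhds (hsub hz₁)
  -- Moving in the direction -φ/φ' shrinks φ radially to first order, so γ is tangent to the
  -- preimage of a ray. Starlikeness makes |γ| decrease, so γ stays in the disc of radius R. Along γ
  -- the derivative of Re(eF/φ)|φ| is -Re(eF'/φ')|φ|, hence Ψ decreases strictly from its minimum, a
  -- contradiction.
  set v : ℂ := φ z₁ / deriv φ z₁ with hv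
  set γ : ℝ → ℂ := fun t => z₁ - t * v with hγ
  have hγ0 : γ 0 = z₁ := by simp [hγ]
  have hγd : HasDerivAt γ (-v) 0 := by
    have : HasDerivAt (fun t : ℝ => (t : ℂ) * v) (1 * v) 0 :=
      (hasDerivAt_id (0 : ℝ)).ofReal_comp.mul_const v
    simpa using this.const_sub z₁
  have hnorm := hasDerivAt_norm_curve hγd (by rwa [hγ0])
  rw [hγ0] at hnorm
  have hvre : (-v / z₁).re = -(φ z₁ / (z₁ * deriv φ z₁)).re := by
    rw [hv, neg_div, neg_re, div_div, mul_comm (deriv φ z₁)]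
  rw [hvre] at hnorm
  have hst₁ := hst z₁ hz₁R hz₁0
  have hz₁n : 0 < ‖z₁‖ := norm_pos_iff.2 hz₁0
  have hev1 := eventually_lt_of_hasDerivAt_neg hnorm (by nlinarith)
  have hφγ : HasDerivAt (fun t => φ (γ t)) (-φ z₁) 0 := by
    have h1 : HasDerivAt φ (deriv φ z₁) (γ 0) := by
      rw [hγ0]; exact (hφ.differentiableAt hzd).hasDerivAt
    have h2 : deriv φ z₁ * -v = -φ z₁ := by rw [hv]; field_simp
    rw [← h2]
    exact h1.comp (0 : ℝ) hγd
  have hFγ : HasDerivAt (fun t => F (γ t)) (-(deriv F z₁ * v)) 0 := by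
    have h1 : HasDerivAt F (deriv F z₁) (γ 0) := by
      rw [hγ0]; exact (hF.differentiableAt hzd).hasDerivAt
    rw [← mul_neg]
    exact h1.comp (0 : ℝ) hγd
  have hq : HasDerivAt (fun t => e * F (γ t) / φ (γ t))
      (e * F z₁ / φ z₁ - e * deriv F z₁ / deriv φ z₁) 0 := by
    have h1 := (hFγ.const_mul e).div hφγ (by rwa [hγ0])
    refine h1.congr_deriv ?_
    simp only [hγ0, hv]
    field_simp
    ring
  have hnφ : HasDerivAt (fun t => ‖φ (γ t)‖) (-‖φ z₁‖) 0 := by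
    have h1 := hasDerivAt_norm_curve hφγ (by rwa [hγ0])
    refine h1.congr_deriv ?_
    simp only [hγ0]
    rw [neg_div, div_self hφz]
    simp
  have hXγ : HasDerivAt (fun t => X ‖γ t‖)
      (Y ‖z₁‖ * (‖z₁‖ * -(φ z₁ / (z₁ * deriv φ z₁)).re)) 0 := by
    have h1 : HasDerivAt X (Y ‖z₁‖) ‖γ 0‖ := by rw [hγ0]; exact hX _ hz₁n hz₁R
    exact h1.comp_of_eq (0 : ℝ) hnorm rfl
  have hre : HasDerivAt (fun t => (e * F (γ t) / φ (γ t)).re)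
      (e * F z₁ / φ z₁ - e * deriv F z₁ / deriv φ z₁).re 0 :=
    (reCLM.hasFDerivAt.comp_hasDerivAt (0 : ℝ) hq)
  have hΨγ := ((hre.mul hnφ).add (hnφ.const_mul ε)).sub hXγ
  have hev2 := eventually_lt_of_hasDerivAt_neg hΨγ (by
    simp only [hγ0, sub_re]
    have h1 := hineq z₁ hz₁R hz₁0
    have h2 : 0 < ‖φ z₁‖ := norm_pos_iff.2 hφz
    nlinarith)
  obtain ⟨t, ht1, ht2⟩ := (hev1.and hev2).exists
  rw [hγ0] at ht1
  have h3 := hle (γ t) (ht1.le.trans hz₁R)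
  simp only [Pi.add_apply, Pi.mul_apply, Pi.sub_apply, hγ0] at ht2
  simp only [hΨ] at h3
  linarith

/-- If `φ` is starlike and `Re (F' / φ') > 0`, then `Re (F / φ) > 0`. -/
theorem re_div_pos_of_re_deriv_div_pos {φ F : ℂ → ℂ}
    (hφ : DifferentiableOn ℂ φ disc) (hF : DifferentiableOn ℂ F disc) (hφ0 : φ 0 = 0)
    (hF0 : F 0 = 0) (hst : ∀ z ∈ disc, z ≠ 0 → 0 < (φ z / (z * deriv φ z)).re)
    (hpos : ∀ z ∈ disc, 0 < (deriv F z / deriv φ z).re) {z : ℂ} (hz : z ∈ disc) (hz0 : z ≠ 0) :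
    0 < (F z / φ z).re := by
  have hR1 : ‖z‖ < 1 := mem_disc.1 hz
  have hsub : closedBall (0 : ℂ) ‖z‖ ⊆ disc := closedBall_subset_disc hR1
  have hφ'ne : ∀ w ∈ disc, deriv φ w ≠ 0 := by
    intro w hw h
    have := hpos w hw
    simp [h] at this
  have hcont : ContinuousOn (fun w => (deriv F w / deriv φ w).re) (closedBall 0 ‖z‖) := by
    refine continuous_re.comp_continuousOn (ContinuousOn.div ?_ ?_ fun w hw => hφ'ne w (hsub hw))
    · exact ((hF.deriv isOpen_disc).continuousOn).mono hsub
    · exact ((hφ.deriv isOpen_disc).continuousOn).mono hsub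
  -- Subtracting cφ from F, with c > 0 the minimum of Re(F'/φ') on the closed disc, turns the weak
  -- conclusion of `le_re_div_mul_norm` into the strict bound Re(F/φ) ≥ c.
  obtain ⟨w, hw, hmin⟩ := (isCompact_closedBall (0 : ℂ) ‖z‖).exists_isMinOn
    ⟨z, by simp⟩ hcont
  set c : ℝ := (deriv F w / deriv φ w).re with hc
  have hcpos : 0 < c := hpos w (hsub hw)
  have key := le_re_div_mul_norm (φ := φ) (F := fun y => F y - c * φ y) (e := 1) (X := fun _ => 0)
    (Y := fun _ => 0) (R := ‖z‖) hR1 hφ (hF.sub (hφ.const_mul _)) hφ0 (by simp [hF0, hφ0])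
    (fun y hy hy0 => hst y (hsub (by simpa using hy)) hy0) rfl
    (fun r _ _ => hasDerivAt_const _ _) continuousOn_const
    (by
      intro y hy hy0
      have hyd : y ∈ disc := hsub (by simpa using hy)
      have h1 : deriv (fun y => F y - c * φ y) y = deriv F y - c * deriv φ y := by
        have hFy := (hF.differentiableAt (disc_mem_nhds hyd))
        have hφy := (hφ.differentiableAt (disc_mem_nhds hyd))
        exact (hFy.hasDerivAt.sub (hφy.hasDerivAt.const_mul _)).deriv
      rw [h1, one_mul, sub_div, mul_div_cancel_right₀ _ (hφ'ne y hyd), sub_re, ofReal_re]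
      simp only [zero_mul]
      have h2 : c ≤ (deriv F y / deriv φ y).re := hmin (by simpa using hy)
      exact mul_nonneg (by linarith) (norm_nonneg _)) le_rfl
  have hφz : φ z ≠ 0 := by
    intro h
    have := hst z hz hz0
    simp [h] at this
  rw [one_mul, sub_div, mul_div_cancel_right₀ _ hφz, sub_re, ofReal_re] at key
  have h3 : 0 < ‖φ z‖ := norm_pos_iff.2 hφz
  have h4 := nonneg_of_mul_nonneg_left key h3
  linarith

/-! ### Functions with positive real part -/

/-- The Schwarz lemma for functions with positive real part. -/
theorem norm_sub_le_of_re_pos {p : ℂ → ℂ} (hp : DifferentiableOn ℂ p disc)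
    (hpos : ∀ z ∈ disc, 0 < (p z).re) {z : ℂ} (hz : z ∈ disc) :
    ‖p z - p 0‖ ≤ ‖z‖ * ‖p z + (starRingEnd ℂ) (p 0)‖ := by
  have h0 := hpos 0 zero_mem_disc
  have hne : ∀ w ∈ disc, p w + (starRingEnd ℂ) (p 0) ≠ 0 := by
    intro w hw h
    have := congrArg re h
    simp at this
    linarith [hpos w hw]
  have hd : DifferentiableOn ℂ (fun w => (p w - p 0) / (p w + (starRingEnd ℂ) (p 0)))
      (ball 0 1) := (hp.sub_const _).div (hp.add_const _) hne
  have := norm_le_norm_of_mapsTo_ball hd (fun w hw => ?_) (by simp) (mem_disc.1 hz)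
  · rwa [norm_div, div_le_iff₀ (norm_pos_iff.2 (hne z hz))] at this
  · rw [mem_closedBall_zero_iff, norm_div, div_le_one (norm_pos_iff.2 (hne w hw))]
    rw [← sq_le_sq₀ (norm_nonneg _) (norm_nonneg _), ← normSq_eq_norm_sq, ← normSq_eq_norm_sq,
      normSq_apply, normSq_apply]
    simp only [sub_re, sub_im, add_re, add_im, conj_re, conj_im]
    nlinarith [hpos w hw, mul_pos (hpos w hw) h0]

/-- The values of a function with positive real part lie in a hyperbolic disc. -/
theorem sq_le_of_re_pos {p : ℂ → ℂ} (hp : DifferentiableOn ℂ p disc)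
    (hpos : ∀ z ∈ disc, 0 < (p z).re) {z : ℂ} (hz : z ∈ disc) :
    (1 - ‖z‖ ^ 2) * ((p z).re ^ 2 + (p 0).re ^ 2 + ((p z).im - (p 0).im) ^ 2) ≤
      2 * (p 0).re * (p z).re * (1 + ‖z‖ ^ 2) := by
  have h := norm_sub_le_of_re_pos hp hpos hz
  have h2 : ‖p z - p 0‖ ^ 2 ≤ ‖z‖ ^ 2 * ‖p z + (starRingEnd ℂ) (p 0)‖ ^ 2 := by
    rw [← mul_pow]; exact pow_le_pow_left₀ (norm_nonneg _) h 2
  rw [← normSq_eq_norm_sq (p z - p 0), ← normSq_eq_norm_sq (p z + _), normSq_apply,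
    normSq_apply] at h2
  simp only [sub_re, sub_im, add_re, add_im, conj_re, conj_im] at h2
  nlinarith

/-- Harnack's inequality. -/
theorem re_ge_of_re_pos {p : ℂ → ℂ} (hp : DifferentiableOn ℂ p disc)
    (hpos : ∀ z ∈ disc, 0 < (p z).re) {z : ℂ} (hz : z ∈ disc) :
    (p 0).re * ((1 - ‖z‖) / (1 + ‖z‖)) ≤ (p z).re := by
  have h := sq_le_of_re_pos hp hpos hz
  have hr := mem_disc.1 hz
  have hr0 := norm_nonneg z
  have h0 := hpos 0 zero_mem_disc
  have hX := hpos z hz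
  rw [← mul_div_assoc, div_le_iff₀ (by linarith)]
  by_contra hcon
  push Not at hcon
  have h1 : (p z).re * (1 - ‖z‖) < (p 0).re * (1 + ‖z‖) := by nlinarith
  nlinarith [mul_pos (sub_pos.2 hcon) (sub_pos.2 h1), sq_nonneg ((p z).im - (p 0).im),
    mul_nonneg (by nlinarith : 0 ≤ 1 - ‖z‖ ^ 2) (sq_nonneg ((p z).im - (p 0).im))]

/-- A lower bound for a function with positive real part in the direction
`(1 - i k) / (1 + i k)`. -/
theorem directional_ge_of_re_pos {p : ℂ → ℂ} (hp : DifferentiableOn ℂ p disc)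
    (hpos : ∀ z ∈ disc, 0 < (p z).re) (k : ℝ) {z : ℂ} (hz : z ∈ disc) :
    (p 0).re * ((1 - ‖z‖) / (1 + ‖z‖) - k ^ 2 * ((1 + ‖z‖) / (1 - ‖z‖))) - 2 * k * (p 0).im ≤
      (1 - k ^ 2) * (p z).re - 2 * k * (p z).im := by
  have h := sq_le_of_re_pos hp hpos hz
  have hr := mem_disc.1 hz
  have hr0 := norm_nonneg z
  have h0 := hpos 0 zero_mem_disc
  set r := ‖z‖
  set X := (p z).re
  set Y := (p z).im
  set x₀ := (p 0).re
  set y₀ := (p 0).im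
  -- Up to the factor 1 - r², (a, b) is the displacement of p(z) from the centre of the Euclidean
  -- disc in `sq_le_of_re_pos`, whose radius becomes 2x₀r.
  set a := (1 - r ^ 2) * X - x₀ * (1 + r ^ 2) with ha
  set b := (1 - r ^ 2) * (Y - y₀) with hb
  have hr2 : 0 < 1 - r ^ 2 := by nlinarith
  have hab : a ^ 2 + b ^ 2 ≤ (2 * x₀ * r) ^ 2 := by
    have := mul_le_mul_of_nonneg_left h hr2.le
    rw [ha, hb]; nlinarith
  -- Cauchy–Schwarz for the vector (1 - k², -2k), which has length 1 + k².
  have hcs : ((1 - k ^ 2) * a - 2 * k * b) ^ 2 ≤ (2 * x₀ * r * (1 + k ^ 2)) ^ 2 := by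
    have h1 : ((1 - k ^ 2) * a - 2 * k * b) ^ 2 ≤ (1 + k ^ 2) ^ 2 * (a ^ 2 + b ^ 2) := by
      nlinarith [sq_nonneg ((1 - k ^ 2) * b + 2 * k * a)]
    have h2 := mul_le_mul_of_nonneg_left hab (sq_nonneg (1 + k ^ 2))
    nlinarith
  have habs := (abs_le.1 (abs_le_of_sq_le_sq hcs (by positivity))).1
  have hm : (1 - r) / (1 + r) - k ^ 2 * ((1 + r) / (1 - r)) =
      ((1 - r) ^ 2 - k ^ 2 * (1 + r) ^ 2) / (1 - r ^ 2) := by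
    have h1 : 1 - r ≠ 0 := by linarith
    have h2 : 1 + r ≠ 0 := by linarith
    have h3 : 1 - r ^ 2 = (1 - r) * (1 + r) := by ring
    rw [h3]; field_simp
  rw [hm]
  have key : x₀ * (((1 - r) ^ 2 - k ^ 2 * (1 + r) ^ 2) / (1 - r ^ 2)) ≤
      (1 - k ^ 2) * X - 2 * k * (Y - y₀) := by
    rw [← mul_div_assoc, div_le_iff₀ hr2]
    rw [ha, hb] at habs
    nlinarith
  linarith

theorem inv_re_pos {w : ℂ} (hw : 0 < w.re) : 0 < (w⁻¹).re := by
  rw [inv_re]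
  have : w ≠ 0 := by rintro rfl; simp at hw
  exact div_pos hw (normSq_pos.2 this)

theorem div_re_pos_symm {w z : ℂ} (h : 0 < (w / z).re) : 0 < (z / w).re := by
  rw [← inv_div]; exact inv_re_pos h

theorem differentiableOn_zDeriv {f : ℂ → ℂ} (hf : DifferentiableOn ℂ f disc) :
    DifferentiableOn ℂ (zDeriv f) disc :=
  differentiableOn_id.mul (hf.deriv isOpen_disc)

theorem zDeriv_zero (f : ℂ → ℂ) : zDeriv f 0 = 0 := by simp [zDeriv]

theorem deriv_zDeriv_zero {f : ℂ → ℂ} (hf : DifferentiableOn ℂ f disc) :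
    deriv (zDeriv f) 0 = deriv f 0 := by
  have h1 := ((hf.deriv isOpen_disc).differentiableAt (disc_mem_nhds zero_mem_disc)).hasDerivAt
  have := (hasDerivAt_id (0 : ℂ)).mul h1
  have h2 : deriv (zDeriv f) 0 = 1 * deriv f 0 + id 0 * deriv (deriv f) 0 := this.deriv
  simpa using h2

theorem deriv_zDeriv {f : ℂ → ℂ} (hf : DifferentiableOn ℂ f disc) {z : ℂ} (hz : z ∈ disc) :
    deriv (zDeriv f) z = deriv f z + z * deriv (deriv f) z := by
  have h1 := ((hf.deriv isOpen_disc).differentiableAt (disc_mem_nhds hz)).hasDerivAt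
  have := (hasDerivAt_id z).mul h1
  have h2 : deriv (zDeriv f) z = 1 * deriv f z + id z * deriv (deriv f) z := this.deriv
  simpa using h2

/-! ### Convex functions: two-point inequalities and distortion -/

namespace IsConvexFunction

variable {g : ℂ → ℂ}

theorem deriv_ne_zero (hg : IsConvexFunction g) {z : ℂ} (hz : z ∈ disc) : deriv g z ≠ 0 :=
  deriv_ne_zero_of_injOn isOpen_disc hg.analytic hg.univalent hz

/-- By convexity w ↦ g(w) + t(g(xw) - g(w)) is subordinate to g, so by Schwarz the preimage of its
value at z has modulus at most |z|. The modulus of this preimage therefore cannot increase at t = 0,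
and its logarithmic derivative there is minus the real part in question. -/
theorem re_sub_div_nonneg (hg : IsConvexFunction g) {x z : ℂ} (hx : ‖x‖ ≤ 1) (hz : z ∈ disc)
    (hz0 : z ≠ 0) : 0 ≤ ((g z - g (x * z)) / (z * deriv g z)).re := by
  by_contra hneg
  push Not at hneg
  set ginv := Function.invFunOn g disc with hginv
  set c : ℝ → ℂ := fun t => ginv (g z + t * (g (x * z) - g z)) with hc
  have hc0 : c 0 = z := by
    simp only [hc, ofReal_zero, zero_mul, add_zero]
    exact hg.univalent.leftInvOn_invFunOn hz
  have hcd : HasDerivAt c ((deriv g z)⁻¹ * (g (x * z) - g z)) 0 := by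
    have h1 : HasDerivAt (fun t : ℝ => g z + (t : ℂ) * (g (x * z) - g z))
        (g (x * z) - g z) 0 := by
      have := (((hasDerivAt_id (0 : ℝ)).ofReal_comp.mul_const (g (x * z) - g z))).const_add (g z)
      simpa using this
    have h2 := hasDerivAt_invFunOn isOpen_disc hg.analytic hg.univalent hz
    have h3 : HasDerivAt ginv (deriv g z)⁻¹ (g z + ((0 : ℝ) : ℂ) * (g (x * z) - g z)) := by
      simpa using h2
    exact h3.comp (0 : ℝ) h1
  have hnd := hasDerivAt_norm_curve hcd (by rwa [hc0])
  rw [hc0] at hnd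
  have heq : ((deriv g z)⁻¹ * (g (x * z) - g z) / z).re =
      -((g z - g (x * z)) / (z * deriv g z)).re := by
    rw [← neg_re]
    congr 1
    have := hg.deriv_ne_zero hz
    field_simp
    ring
  rw [heq] at hnd
  have hzn : 0 < ‖z‖ := norm_pos_iff.2 hz0
  have hev := eventually_lt_of_hasDerivAt_neg hnd.neg (by nlinarith)
  have hev2 : ∀ᶠ t : ℝ in 𝓝[>] 0, t < 1 :=
    (gt_mem_nhds (zero_lt_one)).filter_mono nhdsWithin_le_nhds
  obtain ⟨t, ⟨ht1, ht2⟩, ht0⟩ := ((hev.and hev2).and self_mem_nhdsWithin).exists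
  have ht0 : (0 : ℝ) < t := ht0
  simp only [Pi.neg_apply, hc0, neg_lt_neg_iff] at ht1
  have hle := norm_invFunOn_comp_le (u := fun w => g w + t * (g (x * w) - g w)) hg.analytic
    hg.univalent hg.map_zero
    (hg.analytic.add (((hg.analytic.comp (differentiableOn_id.const_mul x)
      (fun w hw => mul_mem_disc hx hw)).sub hg.analytic).const_mul _))
    (by
      intro w hw
      have h1 : g w ∈ g '' disc := mem_image_of_mem g hw
      have h2 : g (x * w) ∈ g '' disc := mem_image_of_mem g (mul_mem_disc hx hw)
      have := hg.convex_image h1 h2 (a := 1 - t) (b := t) (by linarith) ht0.le (by ring)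
      convert this using 1
      simp only [real_smul]
      push_cast
      ring) (by simp [hg.map_zero]) hz
  simp only [hc] at ht1
  linarith

/-- The quotient extends holomorphically to the origin with value 1 - x, whose real part is positive
because |x| ≤ 1 and x ≠ 1. The minimum principle then excludes zeros of the real part. -/
theorem re_sub_div_pos (hg : IsConvexFunction g) {x z : ℂ} (hx : ‖x‖ ≤ 1) (hx1 : x ≠ 1)
    (hz : z ∈ disc) (hz0 : z ≠ 0) : 0 < ((g z - g (x * z)) / (z * deriv g z)).re := by
  have hdx : DifferentiableOn ℂ (fun w => g w - g (x * w)) disc :=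
    hg.analytic.sub (hg.analytic.comp (differentiableOn_id.const_mul x)
      (fun w hw => mul_mem_disc hx hw))
  have hd0 : HasDerivAt (fun w => g w - g (x * w)) ((1 - x) * deriv g 0) 0 := by
    have h1 := (hg.analytic.differentiableAt (disc_mem_nhds zero_mem_disc)).hasDerivAt
    have h2 : HasDerivAt g (deriv g 0) (x * 0) := by simpa using h1
    have h3 := h2.comp (0 : ℂ) ((hasDerivAt_id (0 : ℂ)).const_mul x)
    refine (h1.sub h3).congr_deriv ?_
    ring
  have hre : 0 < (1 - x).re := by
    rw [sub_re, one_re, sub_pos]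
    refine lt_of_le_of_ne ((re_le_norm x).trans hx) fun h => hx1 ?_
    have h1 : x.re ^ 2 + x.im ^ 2 ≤ 1 := by
      have h2 : normSq x = ‖x‖ ^ 2 := normSq_eq_norm_sq x
      rw [normSq_apply] at h2
      nlinarith [norm_nonneg x]
    have h2 : x.im = 0 := by
      rw [h] at h1
      nlinarith
    exact Complex.ext (by simpa using h) (by simpa using h2)
  set k : ℂ → ℂ := fun w => dslope (fun w => g w - g (x * w)) 0 w / deriv g w with hk
  have hkz : ∀ w, w ≠ 0 → k w = (g w - g (x * w)) / (w * deriv g w) := by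
    intro w hw
    simp only [hk, dslope_of_ne _ hw, slope_def_field, mul_zero, sub_self, sub_zero]
    rw [div_div]
  have hk0 : k 0 = 1 - x := by
    simp only [hk, dslope_same, hd0.deriv]
    exact mul_div_cancel_right₀ _ (hg.deriv_ne_zero zero_mem_disc)
  have hkd : DifferentiableOn ℂ k disc := by
    refine DifferentiableOn.div ?_ (hg.analytic.deriv isOpen_disc) fun w hw => hg.deriv_ne_zero hw
    exact (differentiableOn_dslope (disc_mem_nhds zero_mem_disc)).2 hdx
  rw [← hkz z hz0]
  refine re_pos_of_re_nonneg isOpen_disc isPreconnected_disc hkd (fun w hw => ?_) zero_mem_disc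
    (by rwa [hk0]) hz
  by_cases hw0 : w = 0
  · rw [hw0, hk0]; exact hre.le
  · rw [hkz w hw0]; exact hg.re_sub_div_nonneg hx hw hw0

/-- A convex function is starlike. -/
theorem re_div_pos (hg : IsConvexFunction g) {z : ℂ} (hz : z ∈ disc) (hz0 : z ≠ 0) :
    0 < (g z / (z * deriv g z)).re := by
  have := hg.re_sub_div_pos (x := 0) (by simp) zero_ne_one hz hz0
  simpa [hg.map_zero] using this

/-- When |y| = |z| both y/z and z/y are admissible in `re_sub_div_pos`. Adding the two inverted
inequalities gives the symmetric quotient. -/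
theorem re_zDeriv_sub_div_pos_of_norm_eq (hg : IsConvexFunction g) {y z : ℂ} (hz : z ∈ disc)
    (hyz : ‖y‖ = ‖z‖) (hne : y ≠ z) : 0 < ((zDeriv g z - zDeriv g y) / (g z - g y)).re := by
  have hz0 : z ≠ 0 := by
    rintro rfl
    exact hne (norm_eq_zero.1 (by simpa using hyz))
  have hy0 : y ≠ 0 := by
    rintro rfl
    exact hz0 (norm_eq_zero.1 (by simpa using hyz.symm))
  have hy : y ∈ disc := by rw [mem_disc] at *; rwa [hyz]
  have h1 := hg.re_sub_div_pos (x := y / z) (z := z)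
    (by rw [norm_div, hyz, div_self (norm_ne_zero_iff.2 hz0)])
    (fun h => hne ((div_eq_one_iff_eq hz0).1 h)) hz hz0
  have h2 := hg.re_sub_div_pos (x := z / y) (z := y)
    (by rw [norm_div, hyz, div_self (norm_ne_zero_iff.2 hz0)])
    (fun h => hne ((div_eq_one_iff_eq hy0).1 h).symm) hy hy0
  rw [div_mul_cancel₀ _ hz0] at h1
  rw [div_mul_cancel₀ _ hy0] at h2
  have h3 := add_pos (div_re_pos_symm h1) (div_re_pos_symm h2)
  rw [← add_re] at h3
  rw [← neg_sub (g z) (g y), div_neg, ← sub_eq_add_neg, ← sub_div] at h3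
  exact h3

/-- For fixed z the quotient is holomorphic in y, and the equal-modulus case controls it on the
circle |y| = |z|. The minimum principle fills the disc, with strictness from y = 0, where it equals
zg'/g. The `dslope` form also covers the diagonal y = z, which yields Re(1 + zg''/g') ≥ 0. -/
theorem re_zDeriv_dslope_nonneg (hg : IsConvexFunction g) {y z : ℂ} (hz : z ∈ disc) (hz0 : z ≠ 0)
    (hyz : ‖y‖ ≤ ‖z‖) : 0 ≤ (dslope (zDeriv g) z y / dslope g z y).re ∧
      (‖y‖ < ‖z‖ → 0 < (dslope (zDeriv g) z y / dslope g z y).re) := by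
  have hsub : closedBall (0 : ℂ) ‖z‖ ⊆ disc := closedBall_subset_disc (mem_disc.1 hz)
  have hzn : 0 < ‖z‖ := norm_pos_iff.2 hz0
  set k : ℂ → ℂ := fun y => dslope (zDeriv g) z y / dslope g z y with hk
  have hden : ∀ y ∈ disc, dslope g z y ≠ 0 := by
    intro y hy
    by_cases h : y = z
    · rw [h, dslope_same]; exact hg.deriv_ne_zero hz
    · rw [dslope_of_ne _ h, slope_def_field]
      refine div_ne_zero (sub_ne_zero.2 fun h2 => h (hg.univalent hy hz h2)) (sub_ne_zero.2 h)
  have hkd : DifferentiableOn ℂ k disc :=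
    ((differentiableOn_dslope (disc_mem_nhds hz)).2 (differentiableOn_zDeriv hg.analytic)).div
      ((differentiableOn_dslope (disc_mem_nhds hz)).2 hg.analytic) hden
  have hkne : ∀ y, y ≠ z → k y = (zDeriv g z - zDeriv g y) / (g z - g y) := by
    intro y hy
    simp only [hk, dslope_of_ne _ hy, slope_def_field]
    rw [div_div_div_cancel_right₀ (sub_ne_zero.2 hy), ← neg_sub, ← neg_sub (g z), neg_div_neg_eq]
  -- The point y = z of the circle is reached as a limit along the circle itself.
  have hkz : 0 ≤ (k z).re := by
    have hcont : ContinuousAt (fun θ : ℝ => (k (exp (θ * I) * z)).re) 0 := by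
      have h1 : ContinuousAt k (exp (((0 : ℝ) : ℂ) * I) * z) := by
        simpa using (hkd.differentiableAt (disc_mem_nhds hz)).continuousAt
      refine continuous_re.continuousAt.comp (ContinuousAt.comp (f := fun θ : ℝ => exp (θ * I) * z)
        h1 ?_)
      fun_prop
    have ht : Tendsto (fun θ : ℝ => (k (exp (θ * I) * z)).re) (𝓝[>] 0) (𝓝 (k z).re) := by
      have := hcont.tendsto.mono_left (nhdsWithin_le_nhds (s := Ioi (0 : ℝ)))
      simpa using this
    refine ge_of_tendsto ht ?_
    filter_upwards [Ioo_mem_nhdsGT (show (0 : ℝ) < 1 from one_pos)] with θ hθ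
    have hne : exp (θ * I) * z ≠ z := by
      intro h
      have h1 : exp (θ * I) = 1 := mul_right_cancel₀ hz0 (by rw [h, one_mul])
      have h2 := congrArg im h1
      rw [exp_ofReal_mul_I_im, one_im] at h2
      exact (Real.sin_pos_of_pos_of_lt_pi hθ.1 (by linarith [hθ.2, Real.pi_gt_three])).ne' h2
    rw [hkne _ hne]
    exact (hg.re_zDeriv_sub_div_pos_of_norm_eq hz
      (by rw [norm_mul, norm_exp_ofReal_mul_I, one_mul]) hne).le
  have hnn : ∀ y ∈ closedBall (0 : ℂ) ‖z‖, 0 ≤ (k y).re := by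
    intro y hy
    refine re_nonneg_of_sphere hzn (hkd.mono hsub) (fun w hw => ?_) hy
    by_cases h : w = z
    · rw [h]; exact hkz
    · rw [hkne w h]
      exact (hg.re_zDeriv_sub_div_pos_of_norm_eq hz (by simpa using hw) h).le
  refine ⟨hnn y (by simpa using hyz), fun hlt => ?_⟩
  refine re_pos_of_re_nonneg (U := ball 0 ‖z‖) isOpen_ball (convex_ball _ _).isPreconnected
    (hkd.mono (ball_subset_closedBall.trans hsub)) (fun w hw => hnn w (ball_subset_closedBall hw))
    (mem_ball_self hzn) ?_ (by simpa using hlt)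
  rw [hkne 0 hz0.symm, zDeriv_zero, hg.map_zero, sub_zero, sub_zero]
  exact div_re_pos_symm (hg.re_div_pos hz hz0)

/-- With y = xz this says that g(w) - g(xw) is starlike, the starting point for the univalence of
𝒞₃. -/
theorem re_zDeriv_sub_div_pos (hg : IsConvexFunction g) {y z : ℂ} (hz : z ∈ disc)
    (hyz : ‖y‖ ≤ ‖z‖) (hne : y ≠ z) : 0 < ((zDeriv g z - zDeriv g y) / (g z - g y)).re := by
  rcases hyz.eq_or_lt with h | h
  · exact hg.re_zDeriv_sub_div_pos_of_norm_eq hz h hne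
  · have hz0 : z ≠ 0 := by
      rintro rfl
      exact absurd h (by simp)
    have := (hg.re_zDeriv_dslope_nonneg hz hz0 hyz).2 h
    rwa [dslope_of_ne _ hne, dslope_of_ne _ hne, slope_def_field, slope_def_field,
      div_div_div_cancel_right₀ (sub_ne_zero.2 hne), ← neg_sub, ← neg_sub (g z),
      neg_div_neg_eq] at this

theorem differentiableOn_deriv_zDeriv_div (hg : IsConvexFunction g) :
    DifferentiableOn ℂ (fun z => deriv (zDeriv g) z / deriv g z) disc :=
  ((differentiableOn_zDeriv hg.analytic).deriv isOpen_disc).div (hg.analytic.deriv isOpen_disc)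
    fun _ hw => hg.deriv_ne_zero hw

theorem deriv_zDeriv_div_zero (hg : IsConvexFunction g) :
    deriv (zDeriv g) 0 / deriv g 0 = 1 := by
  rw [deriv_zDeriv_zero hg.analytic, div_self (hg.deriv_ne_zero zero_mem_disc)]

/-- The analytic characterization of convexity, `Re (1 + z g'' / g') > 0`. -/
theorem re_deriv_zDeriv_div_pos (hg : IsConvexFunction g) {z : ℂ} (hz : z ∈ disc) :
    0 < (deriv (zDeriv g) z / deriv g z).re := by
  refine re_pos_of_re_nonneg isOpen_disc isPreconnected_disc
    (k := fun z => deriv (zDeriv g) z / deriv g z) hg.differentiableOn_deriv_zDeriv_div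
    (fun w hw => ?_) zero_mem_disc ?_ hz
  · by_cases hw0 : w = 0
    · rw [hw0]; simp [hg.deriv_zDeriv_div_zero]
    · have := (hg.re_zDeriv_dslope_nonneg hw hw0 le_rfl).1
      simpa [dslope_same] using this
  · simp [hg.deriv_zDeriv_div_zero]

/-- Harnack's inequality for 1 + zg''/g' makes |g'(tz)|(1 + t|z|)² increasing in t. -/
theorem norm_deriv_ge (hg : IsConvexFunction g) {z : ℂ} (hz : z ∈ disc) :
    ‖deriv g 0‖ / (1 + ‖z‖) ^ 2 ≤ ‖deriv g z‖ := by
  have hr := mem_disc.1 hz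
  set r := ‖z‖ with hrdef
  have hr0 : 0 ≤ r := norm_nonneg z
  have htz : ∀ t ∈ Icc (0 : ℝ) 1, (t : ℂ) * z ∈ disc := by
    intro t ht
    exact mul_mem_disc (by rw [norm_real, Real.norm_of_nonneg ht.1]; exact ht.2) hz
  have hntz : ∀ t ∈ Icc (0 : ℝ) 1, ‖(t : ℂ) * z‖ = t * r := by
    intro t ht
    rw [norm_mul, norm_real, Real.norm_of_nonneg ht.1]
  have hcurve : ∀ t ∈ Icc (0 : ℝ) 1, HasDerivAt (fun t : ℝ => deriv g ((t : ℂ) * z))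
      (deriv (deriv g) ((t : ℂ) * z) * z) t := by
    intro t ht
    have h1 := ((hg.analytic.deriv isOpen_disc).differentiableAt
      (disc_mem_nhds (htz t ht))).hasDerivAt
    have h2 : HasDerivAt (fun t : ℝ => (t : ℂ) * z) z t := by
      simpa using (hasDerivAt_id t).ofReal_comp.mul_const z
    exact h1.comp t h2
  have hD : ∀ t ∈ Icc (0 : ℝ) 1, HasDerivAt (fun t : ℝ => ‖deriv g ((t : ℂ) * z)‖ * (1 + t * r) ^ 2)
      (‖deriv g ((t : ℂ) * z)‖ * (deriv (deriv g) ((t : ℂ) * z) * z / deriv g ((t : ℂ) * z)).re *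
        (1 + t * r) ^ 2 + ‖deriv g ((t : ℂ) * z)‖ * (2 * (1 + t * r) * r)) t := by
    intro t ht
    have h1 := hasDerivAt_norm_curve (hcurve t ht) (hg.deriv_ne_zero (htz t ht))
    have h2 : HasDerivAt (fun t : ℝ => (1 + t * r) ^ 2) (2 * (1 + t * r) * r) t := by
      have := (((hasDerivAt_id t).mul_const r).const_add 1).pow 2
      refine this.congr_deriv ?_
      simp
    exact h1.mul h2
  have hmono : MonotoneOn (fun t : ℝ => ‖deriv g ((t : ℂ) * z)‖ * (1 + t * r) ^ 2) (Icc 0 1) := by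
    refine monotoneOn_of_deriv_nonneg (convex_Icc 0 1)
      (fun t ht => (hD t ht).continuousAt.continuousWithinAt)
      (fun t ht => (hD t (interior_subset ht)).differentiableAt.differentiableWithinAt) ?_
    intro t ht
    rw [interior_Icc] at ht
    have ht' : t ∈ Icc (0 : ℝ) 1 := Ioo_subset_Icc_self ht
    rw [(hD t ht').deriv]
    have hQ := re_ge_of_re_pos hg.differentiableOn_deriv_zDeriv_div
      (fun w hw => hg.re_deriv_zDeriv_div_pos hw) (htz t ht')
    rw [hg.deriv_zDeriv_div_zero, one_re, one_mul, hntz t ht', deriv_zDeriv hg.analytic (htz t ht'),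
      add_div, div_self (hg.deriv_ne_zero (htz t ht')), add_re, one_re] at hQ
    set q := (deriv (deriv g) ((t : ℂ) * z) * z / deriv g ((t : ℂ) * z)).re with hq
    have hqt : ((t : ℂ) * z * deriv (deriv g) ((t : ℂ) * z) / deriv g ((t : ℂ) * z)).re = t * q := by
      rw [hq, ← re_ofReal_mul]
      congr 1; ring
    rw [hqt] at hQ
    have htr : 0 ≤ t * r := mul_nonneg ht.1.le hr0
    rw [div_le_iff₀ (by linarith)] at hQ
    have h3 : 0 ≤ q * (1 + t * r) + 2 * r := by
      have h4 : 0 ≤ t * (q * (1 + t * r) + 2 * r) := by nlinarith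
      exact nonneg_of_mul_nonneg_right h4 ht.1
    have h5 := mul_nonneg (mul_nonneg (norm_nonneg (deriv g ((t : ℂ) * z)))
      (by linarith : 0 ≤ 1 + t * r)) h3
    nlinarith
  have := hmono (left_mem_Icc.2 zero_le_one) (right_mem_Icc.2 zero_le_one) zero_le_one
  rw [div_le_iff₀ (by positivity)]
  simpa using this

/-- (zg')' is g' times 1 + zg''/g'. Each factor has its own lower bound. -/
theorem norm_deriv_zDeriv_ge (hg : IsConvexFunction g) {z : ℂ} (hz : z ∈ disc) :
    ‖deriv g 0‖ * ((1 - ‖z‖) / (1 + ‖z‖) ^ 3) ≤ ‖deriv (zDeriv g) z‖ := by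
  have h1 := hg.norm_deriv_ge hz
  have hQ := re_ge_of_re_pos hg.differentiableOn_deriv_zDeriv_div
      (fun w hw => hg.re_deriv_zDeriv_div_pos hw) hz
  rw [hg.deriv_zDeriv_div_zero, one_re, one_mul] at hQ
  have h2 := hQ.trans (re_le_norm _)
  rw [norm_div, le_div_iff₀ (norm_pos_iff.2 (hg.deriv_ne_zero hz))] at h2
  refine le_trans ?_ h2
  have hr := mem_disc.1 hz
  have hr0 : 0 ≤ ‖z‖ := norm_nonneg z
  have h3 : 0 ≤ (1 - ‖z‖) / (1 + ‖z‖) := div_nonneg (by linarith) (by linarith)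
  refine le_trans (le_of_eq ?_) (mul_le_mul_of_nonneg_left h1 h3)
  field_simp

end IsConvexFunction

/-! ### Growth of z(zf')' when g'(0) need not be real -/

/-- `f` and `g` witness membership in `𝒞₃`, with the normalization `f(z) = z + ⋯`. -/
structure IsC3Pair (f g : ℂ → ℂ) : Prop where
  analytic : DifferentiableOn ℂ f disc
  map_zero : f 0 = 0
  deriv_zero : deriv f 0 = 1
  convex : IsConvexFunction g
  re_pos : ∀ z ∈ disc, 0 < (deriv (zDeriv (zDeriv f)) z / deriv (zDeriv g) z).re

theorem growth_polynomial_nonneg {r u : ℝ} (hr0 : 0 ≤ r) (hr : r ≤ 4 / 5) (hu0 : 0 ≤ u) :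
    0 ≤ (2 - 4 / 3 * r ^ 2 - 2 / 3 * r ^ 3) + u * (2 + 2 / 3 * r) -
      ((1 + r) ^ 2 + u) * (1 + r) ^ 3 * (1 / 2 - 2 * r ^ 2) := by
  have hp0 : 0 ≤ (2 - 4 / 3 * r ^ 2 - 2 / 3 * r ^ 3) -
      (1 + r) ^ 5 * (1 / 2 - 2 * r ^ 2) := by
    have e2 : (2 - 4 / 3 * r ^ 2 - 2 / 3 * r ^ 3) - (1 + r) ^ 5 * (1 / 2 - 2 * r ^ 2) =
        (3 / 2 - 5 / 2 * r - 13 / 3 * r ^ 2 + 13 / 3 * r ^ 3 + 35 / 2 * r ^ 4) +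
        (39 / 2 * r ^ 5 + 10 * r ^ 6 + 2 * r ^ 7) := by ring
    have e3 : 0 ≤ 39 / 2 * r ^ 5 + 10 * r ^ 6 + 2 * r ^ 7 := by positivity
    rw [e2]
    -- The terms of degree at least 5 are dropped. The points 2/5 and √(7/50) are close to the
    -- minimizer of the remaining quartic.
    nlinarith [sq_nonneg (r ^ 2 - 7 / 50), mul_nonneg hr0 (sq_nonneg (r - 2 / 5)),
      sq_nonneg (r - 2 / 5)]
  have hp1 : 0 ≤ (2 + 2 / 3 * r) - (1 + r) ^ 3 * (1 / 2 - 2 * r ^ 2) := by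
    have e2 : (2 + 2 / 3 * r) - (1 + r) ^ 3 * (1 / 2 - 2 * r ^ 2) =
        (3 / 2 - 5 / 6 * r) + (1 / 2 * r ^ 2 + 11 / 2 * r ^ 3 + 6 * r ^ 4 + 2 * r ^ 5) := by
      ring
    have e3 : 0 ≤ 1 / 2 * r ^ 2 + 11 / 2 * r ^ 3 + 6 * r ^ 4 + 2 * r ^ 5 := by positivity
    rw [e2]
    linarith
  have h := mul_nonneg hu0 hp1
  linarith

/-- Here u = tan²(α/2) with α = arg g'(0), so that (1 - u)/(1 + u) = cos α and u/(2(1 + u)) is the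
defect. The right side is the estimate of `norm_zDeriv_zDeriv_ge` for k = tan(α/2)/(1 + r), and the
factor 1 + u/(1 + r)² on the left is 1 + k². -/
theorem growth_le_of_le {r u : ℝ} (hr0 : 0 ≤ r) (hr : r ≤ 4 / 5) (hu0 : 0 ≤ u) :
    (1 + u / (1 + r) ^ 2) * (r * ((3 + r ^ 2) / (3 * (1 + r) ^ 3) +
      u / (2 * (1 + u)) * (r - 4 * r ^ 3))) ≤
    (1 - u) / (1 + u) * (r * (3 + r ^ 2) / (3 * (1 + r) ^ 3) -
      u / (1 + r) ^ 2 * (r / (1 + r))) + 4 * u / ((1 + r) * (1 + u)) * (r / (1 + r) ^ 2) := by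
  have hdiff : (1 - u) / (1 + u) * (r * (3 + r ^ 2) / (3 * (1 + r) ^ 3) -
      u / (1 + r) ^ 2 * (r / (1 + r))) + 4 * u / ((1 + r) * (1 + u)) * (r / (1 + r) ^ 2) -
      (1 + u / (1 + r) ^ 2) * (r * ((3 + r ^ 2) / (3 * (1 + r) ^ 3) +
        u / (2 * (1 + u)) * (r - 4 * r ^ 3))) =
      r ^ 2 * u * ((2 - 4 / 3 * r ^ 2 - 2 / 3 * r ^ 3) + u * (2 + 2 / 3 * r) -
        ((1 + r) ^ 2 + u) * (1 + r) ^ 3 * (1 / 2 - 2 * r ^ 2)) /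
        ((1 + u) * (1 + r) ^ 5) := by
    field_simp
    ring
  have hpoly := growth_polynomial_nonneg hr0 hr hu0
  rw [← sub_nonneg, hdiff]
  exact div_nonneg (mul_nonneg (by positivity) hpoly) (by positivity)

/-- This is the nonnegativity hypothesis of `norm_zDeriv_zDeriv_ge` for k² = u/(1 + r)². With q = (1
- ρ)(1 + r) ≥ (1 + ρ)/5, the numerator is at least (1 + ρ)² times u² - 6u/25 + 1/25, which is
positive. -/
theorem direction_admissible {r ρ u : ℝ} (hρ0 : 0 ≤ ρ) (hρr : ρ ≤ r) (hr : r ≤ 4 / 5)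
    (hu0 : 0 ≤ u) (hu1 : u ≤ 1) :
    0 ≤ (1 - u) / (1 + u) * ((1 - ρ) / (1 + ρ) - u / (1 + r) ^ 2 * ((1 + ρ) / (1 - ρ))) +
      4 * u / ((1 + r) * (1 + u)) := by
  have hρ1 : 0 < 1 - ρ := by linarith
  have hr0 : 0 ≤ r := hρ0.trans hρr
  have hid : (1 - u) / (1 + u) * ((1 - ρ) / (1 + ρ) - u / (1 + r) ^ 2 * ((1 + ρ) / (1 - ρ))) +
      4 * u / ((1 + r) * (1 + u)) = ((1 - u) * (((1 - ρ) * (1 + r)) ^ 2 - u * (1 + ρ) ^ 2) +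
      4 * u * ((1 - ρ) * (1 + r)) * (1 + ρ)) / ((1 + u) * (1 + r) ^ 2 * (1 - ρ) * (1 + ρ)) := by
    field_simp
  rw [hid]
  refine div_nonneg ?_ (by positivity)
  have hq : (1 + ρ) * (1 / 5) ≤ (1 - ρ) * (1 + r) := by nlinarith
  set q := (1 - ρ) * (1 + r)
  have h5 : ((1 + ρ) * (1 / 5)) ^ 2 ≤ q ^ 2 := pow_le_pow_left₀ (by positivity) hq 2
  have h6 := mul_le_mul_of_nonneg_left h5 (sub_nonneg.2 hu1)
  have h7 := mul_le_mul_of_nonneg_left hq (by positivity : 0 ≤ 4 * u * (1 + ρ))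
  have h8 := mul_nonneg (sq_nonneg (1 + ρ)) (sq_nonneg (u - 3 / 25))
  have h9 := sq_nonneg (1 + ρ)
  nlinarith

/-- For r > 4/5 the weight r - 4r³ is so negative that the error term absorbs the loss of the factor
cos(arg g'(0)). -/
theorem growth_weight_le {r : ℝ} (hr : 4 / 5 < r) (hr1 : r < 1) :
    (3 + r ^ 2) / (3 * (1 + r) ^ 3) ≤ (4 * r ^ 3 - r) / 4 := by
  have hr0 : 0 ≤ r := by linarith
  rw [div_le_div_iff₀ (by positivity) (by norm_num)]
  have h2 : (5 : ℝ) ≤ (1 + r) ^ 3 :=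
    le_trans (by norm_num) (pow_le_pow_left₀ (by norm_num : (0 : ℝ) ≤ 9 / 5) (by linarith) 3)
  have h3 : (6 / 5 : ℝ) ≤ 4 * r ^ 3 - r := by
    have h4 : (16 / 25 : ℝ) ≤ r ^ 2 := by nlinarith
    have h5 := mul_le_mul_of_nonneg_left h4 hr0
    nlinarith
  have h4 : r ^ 2 ≤ 1 := by nlinarith
  have h5 : (6 / 5 : ℝ) * 5 ≤ (4 * r ^ 3 - r) * (1 + r) ^ 3 :=
    mul_le_mul h3 h2 (by norm_num) (by linarith)
  linarith

namespace IsC3Pair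

variable {f g : ℂ → ℂ}

theorem analytic_one (h : IsC3Pair f g) : DifferentiableOn ℂ (zDeriv f) disc :=
  differentiableOn_zDeriv h.analytic

theorem analytic_two (h : IsC3Pair f g) : DifferentiableOn ℂ (zDeriv (zDeriv f)) disc :=
  differentiableOn_zDeriv h.analytic_one

theorem analytic_g (h : IsC3Pair f g) : DifferentiableOn ℂ (zDeriv g) disc :=
  differentiableOn_zDeriv h.convex.analytic

theorem deriv_zDeriv_ne_zero (h : IsC3Pair f g) {z : ℂ} (hz : z ∈ disc) :
    deriv (zDeriv g) z ≠ 0 := by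
  intro h0
  have := h.re_pos z hz
  simp [h0] at this

/-- The function `(z (z f')')' / (z g')'`. -/
def quot (f g : ℂ → ℂ) (z : ℂ) : ℂ := deriv (zDeriv (zDeriv f)) z / deriv (zDeriv g) z

theorem differentiableOn_quot (h : IsC3Pair f g) : DifferentiableOn ℂ (quot f g) disc :=
  (h.analytic_two.deriv isOpen_disc).div (h.analytic_g.deriv isOpen_disc)
    fun _ hz => h.deriv_zDeriv_ne_zero hz

theorem quot_zero (h : IsC3Pair f g) : quot f g 0 = (deriv g 0)⁻¹ := by
  rw [quot, deriv_zDeriv_zero h.analytic_one, deriv_zDeriv_zero h.analytic, h.deriv_zero,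
    deriv_zDeriv_zero h.convex.analytic, one_div]

theorem re_zDeriv_div_pos (h : IsC3Pair f g) {z : ℂ} (hz : z ∈ disc) (hz0 : z ≠ 0) :
    0 < (zDeriv g z / (z * deriv (zDeriv g) z)).re := by
  rw [zDeriv, mul_div_mul_left _ _ hz0]
  exact div_re_pos_symm (h.convex.re_deriv_zDeriv_div_pos hz)

/-- The real part of `g'(0) / |g'(0)|`. -/
def cosArg (g : ℂ → ℂ) : ℝ := (deriv g 0).re / ‖deriv g 0‖

/-- The imaginary part of `g'(0) / |g'(0)|`. -/
def sinArg (g : ℂ → ℂ) : ℝ := (deriv g 0).im / ‖deriv g 0‖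

theorem norm_deriv_pos (h : IsC3Pair f g) : 0 < ‖deriv g 0‖ :=
  norm_pos_iff.2 (h.convex.deriv_ne_zero zero_mem_disc)

theorem cosArg_pos (h : IsC3Pair f g) : 0 < cosArg g :=
  div_pos h.convex.re_deriv_zero_pos h.norm_deriv_pos

theorem cosArg_sq_add (h : IsC3Pair f g) : cosArg g ^ 2 + sinArg g ^ 2 = 1 := by
  have h1 : normSq (deriv g 0) = ‖deriv g 0‖ ^ 2 := normSq_eq_norm_sq _
  rw [normSq_apply] at h1
  have h2 := h.norm_deriv_pos.ne'
  rw [cosArg, sinArg, div_pow, div_pow, ← add_div, div_eq_one_iff_eq (pow_ne_zero 2 h2), ← h1]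
  ring

theorem cosArg_le_one (h : IsC3Pair f g) : cosArg g ≤ 1 := by
  nlinarith [h.cosArg_sq_add, h.cosArg_pos, sq_nonneg (sinArg g)]

theorem quot_zero_re (h : IsC3Pair f g) : (quot f g 0).re = cosArg g / ‖deriv g 0‖ := by
  rw [h.quot_zero, inv_re, cosArg, normSq_eq_norm_sq, div_div, sq]

theorem quot_zero_im (h : IsC3Pair f g) : (quot f g 0).im = -sinArg g / ‖deriv g 0‖ := by
  rw [h.quot_zero, inv_im, sinArg, normSq_eq_norm_sq, ← neg_div, div_div, sq]

/-- A lower bound for `|z (z f')'|` obtained from the direction `(1 - i k) / (1 + i k)`. -/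
theorem norm_zDeriv_zDeriv_ge (h : IsC3Pair f g) {k R : ℝ} (hR : R < 1)
    (hk : ∀ r, 0 < r → r ≤ R → 0 ≤ cosArg g * ((1 - r) / (1 + r) - k ^ 2 * ((1 + r) / (1 - r))) +
      2 * k * sinArg g) {z : ℂ} (hz : ‖z‖ ≤ R) :
    cosArg g * (‖z‖ * (3 + ‖z‖ ^ 2) / (3 * (1 + ‖z‖) ^ 3) - k ^ 2 * (‖z‖ / (1 + ‖z‖))) +
      2 * k * sinArg g * (‖z‖ / (1 + ‖z‖) ^ 2) ≤ (1 + k ^ 2) * ‖zDeriv (zDeriv f) z‖ := by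
  set c := cosArg g with hc
  set s := sinArg g with hs
  have hb := h.norm_deriv_pos
  set nb := ‖deriv g 0‖ with hnb
  have hmem : ∀ w : ℂ, ‖w‖ ≤ R → w ∈ disc := fun w hw => mem_disc.2 (hw.trans_lt hR)
  -- X is the antiderivative, vanishing at 0, of the directional lower bound times the distortion
  -- factor (1 - r)/(1 + r)³.
  have hXd : ∀ r : ℝ, 0 ≤ r → HasDerivAt (fun r : ℝ => c * (r * (3 + r ^ 2) / (3 * (1 + r) ^ 3) -
      k ^ 2 * (r / (1 + r))) + 2 * k * s * (r / (1 + r) ^ 2))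
      ((c * ((1 - r) ^ 2 / (1 + r) ^ 4 - k ^ 2 * (1 / (1 + r) ^ 2)) +
        2 * k * s * ((1 - r) / (1 + r) ^ 3))) r := by
    intro r hr
    have hne : 1 + r ≠ 0 := by positivity
    have hid := hasDerivAt_id' r
    have h1 := hid.const_add 1
    have hA := (hid.mul ((hid.pow 2).const_add 3)).div ((h1.pow 3).const_mul 3)
      (by positivity : 3 * (1 + r) ^ 3 ≠ 0)
    have hC := (hid.div h1 hne).const_mul (k ^ 2)
    have hH := (hid.div (h1.pow 2) (pow_ne_zero 2 hne)).const_mul (2 * k * s)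
    refine (((hA.sub hC).const_mul c).add hH).congr_deriv ?_
    simp only [Pi.mul_apply, Pi.pow_apply]
    field_simp
    ring
  -- The multiplier e is (1 + ik)², of modulus 1 + k².
  have key := le_re_div_mul_norm (φ := zDeriv g) (F := zDeriv (zDeriv f))
    (e := (1 - k ^ 2 : ℝ) + (2 * k : ℝ) * I) hR h.analytic_g h.analytic_two (zDeriv_zero _)
    (zDeriv_zero _) (fun w hw hw0 => h.re_zDeriv_div_pos (hmem w hw) hw0)
    (X := fun r : ℝ => c * (r * (3 + r ^ 2) / (3 * (1 + r) ^ 3) -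
      k ^ 2 * (r / (1 + r))) + 2 * k * s * (r / (1 + r) ^ 2))
    (Y := fun r : ℝ => c * ((1 - r) ^ 2 / (1 + r) ^ 4 - k ^ 2 * (1 / (1 + r) ^ 2)) +
        2 * k * s * ((1 - r) / (1 + r) ^ 3)) (by simp) (fun r hr _ => hXd r hr.le)
    (fun r hr => (hXd r hr.1).continuousAt.continuousWithinAt)
    (by
      intro w hw hw0
      have hwd := hmem w hw
      have hr1 := mem_disc.1 hwd
      have hr0 : 0 < ‖w‖ := norm_pos_iff.2 hw0
      have hdir := directional_ge_of_re_pos h.differentiableOn_quot h.re_pos k hwd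
      rw [h.quot_zero_re, h.quot_zero_im, ← hc, ← hs, ← hnb] at hdir
      have hy := hk ‖w‖ hr0 hw
      have hdist := h.convex.norm_deriv_zDeriv_ge hwd
      rw [← hnb] at hdist
      set r := ‖w‖ with hr
      set y : ℝ := c * ((1 - r) / (1 + r) - k ^ 2 * ((1 + r) / (1 - r))) + 2 * k * s with hyd
      have hne : 1 + r ≠ 0 := by positivity
      have hne' : 1 - r ≠ 0 := by linarith
      have hYy : c * ((1 - r) ^ 2 / (1 + r) ^ 4 - k ^ 2 * (1 / (1 + r) ^ 2)) +
        2 * k * s * ((1 - r) / (1 + r) ^ 3) = y * ((1 - r) / (1 + r) ^ 3) := by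
        rw [hyd]; field_simp
      have hre : (((1 - k ^ 2 : ℝ) + (2 * k : ℝ) * I) * deriv (zDeriv (zDeriv f)) w /
          deriv (zDeriv g) w).re = (1 - k ^ 2) * (quot f g w).re - 2 * k * (quot f g w).im := by
        rw [mul_div_assoc, quot]
        simp [-ofReal_sub, -ofReal_mul, -ofReal_pow, mul_re]
      have hlow : y / nb ≤ (1 - k ^ 2) * (quot f g w).re - 2 * k * (quot f g w).im := by
        refine le_trans (le_of_eq ?_) hdir
        rw [hyd]; field_simp; ring
      rw [hre, hYy]
      have hQ : zDeriv g w / (w * deriv (zDeriv g) w) = deriv g w / deriv (zDeriv g) w := by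
        rw [zDeriv, mul_div_mul_left _ _ hw0]
      have hh'0 := h.deriv_zDeriv_ne_zero hwd
      have hh'pos : 0 < ‖deriv (zDeriv g) w‖ := norm_pos_iff.2 hh'0
      rw [hQ]
      have hre2 : (deriv g w / deriv (zDeriv g) w).re ≤ ‖deriv g w‖ / ‖deriv (zDeriv g) w‖ := by
        rw [← norm_div]; exact re_le_norm _
      have hnormh : ‖zDeriv g w‖ = r * ‖deriv g w‖ := by rw [zDeriv, norm_mul]
      have hκ : 0 ≤ (1 - r) / (1 + r) ^ 3 := div_nonneg (by linarith) (by positivity)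
      -- Since y ≥ 0 by `hk`, replacing the real part by the modulus preserves the inequality. Then
      -- the lower distortion bound for (zg')' removes the quotient.
      calc y * ((1 - r) / (1 + r) ^ 3) * r * (deriv g w / deriv (zDeriv g) w).re
          ≤ y * ((1 - r) / (1 + r) ^ 3) * r * (‖deriv g w‖ / ‖deriv (zDeriv g) w‖) :=
            mul_le_mul_of_nonneg_left hre2 (by positivity)
        _ = y / nb * (r * ‖deriv g w‖) * ((nb * ((1 - r) / (1 + r) ^ 3)) /
              ‖deriv (zDeriv g) w‖) := by field_simp
        _ ≤ y / nb * (r * ‖deriv g w‖) * 1 := by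
            refine mul_le_mul_of_nonneg_left ?_ (by positivity)
            rwa [div_le_one hh'pos]
        _ ≤ ((1 - k ^ 2) * (quot f g w).re - 2 * k * (quot f g w).im) * ‖zDeriv g w‖ := by
            rw [mul_one, hnormh]
            exact mul_le_mul_of_nonneg_right hlow (by positivity)) hz
  refine key.trans ?_
  have hnorme : ‖((1 - k ^ 2 : ℝ) + (2 * k : ℝ) * I : ℂ)‖ = 1 + k ^ 2 := by
    rw [norm_add_mul_I, show (1 - k ^ 2) ^ 2 + (2 * k) ^ 2 = (1 + k ^ 2) ^ 2 by ring]
    exact Real.sqrt_sq (by positivity)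
  by_cases hz0 : zDeriv g z = 0
  · rw [hz0, norm_zero, mul_zero]; positivity
  · refine (mul_le_mul_of_nonneg_right (re_le_norm _) (norm_nonneg _)).trans ?_
    rw [norm_div, div_mul_cancel₀ _ (norm_ne_zero_iff.2 hz0), norm_mul, hnorme]

/-- The deficiency of `g'(0)` from being real. -/
def defect (g : ℂ → ℂ) : ℝ := (1 - cosArg g) / 4

/-- The main term r(3 + r²)/(3(1 + r)³) is the modulus of z(zf₀')' at -r. The weight r - 4r³ has
antiderivative r²/2 - r⁴. Dividing that by r and integrating again gives (r² - r⁴)/4, which is zero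
at r = 1. -/
theorem norm_zDeriv_zDeriv_ge_mul (h : IsC3Pair f g) {z : ℂ} (hz : z ∈ disc) :
    ‖z‖ * ((3 + ‖z‖ ^ 2) / (3 * (1 + ‖z‖) ^ 3) + defect g * (‖z‖ - 4 * ‖z‖ ^ 3)) ≤
      ‖zDeriv (zDeriv f) z‖ := by
  have hr1 := mem_disc.1 hz
  have hr0 : 0 ≤ ‖z‖ := norm_nonneg z
  have hc0 := h.cosArg_pos
  have hc1 := h.cosArg_le_one
  have hcs := h.cosArg_sq_add
  by_cases hr8 : ‖z‖ ≤ 4 / 5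
  -- τ = tan(α/2) for α = arg g'(0). The direction k = τ/(1 + |z|) depends on the point where the
  -- bound is wanted, and is then held fixed on the whole disc of radius |z|.
  · set τ := sinArg g / (1 + cosArg g) with hτ
    set u := τ ^ 2 with hu
    have h1c : 0 < 1 + cosArg g := by linarith
    have hsτ : sinArg g = τ * (1 + cosArg g) := by rw [hτ]; field_simp
    have hu0 : 0 ≤ u := sq_nonneg τ
    have hcu : cosArg g * (1 + u) = 1 - u := by
      have h2 : (1 + cosArg g) * (cosArg g * (1 + u) - (1 - u)) = 0 := by
        have h3 : sinArg g ^ 2 = u * (1 + cosArg g) ^ 2 := by rw [hsτ, hu]; ring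
        rw [h3] at hcs
        linear_combination hcs
      have := (mul_eq_zero.1 h2).resolve_left h1c.ne'
      linarith
    have hu1 : u ≤ 1 := by nlinarith
    have hceq : cosArg g = (1 - u) / (1 + u) := by rw [eq_div_iff (by linarith)]; exact hcu
    have hseq : sinArg g = 2 * τ / (1 + u) := by
      rw [eq_div_iff (by linarith), hsτ]
      linear_combination τ * hcu
    have hk2 : (τ / (1 + ‖z‖)) ^ 2 = u / (1 + ‖z‖) ^ 2 := by rw [div_pow]
    have hks : 2 * (τ / (1 + ‖z‖)) * sinArg g = 4 * u / ((1 + ‖z‖) * (1 + u)) := by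
      rw [hseq, hu]; field_simp; ring
    have hdef : defect g = u / (2 * (1 + u)) := by
      rw [defect, hceq]; field_simp; ring
    have hB := h.norm_zDeriv_zDeriv_ge (k := τ / (1 + ‖z‖)) (R := ‖z‖) hr1 (by
      intro ρ hρ0 hρr
      rw [hk2, hks, hceq]
      exact direction_admissible hρ0.le hρr hr8 hu0 hu1) le_rfl
    rw [hk2, hks, hceq] at hB
    refine le_of_mul_le_mul_left (le_trans ?_ hB) (by positivity : 0 < 1 + u / (1 + ‖z‖) ^ 2)
    rw [hdef]
    exact growth_le_of_le hr0 hr8 hu0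
  -- Near the boundary the direction k = 0 suffices: it loses only the factor cos α, which the
  -- negative error term allows.
  · push Not at hr8
    have hB := h.norm_zDeriv_zDeriv_ge (k := 0) (R := ‖z‖) hr1 (by
      intro ρ hρ0 hρr
      have : 0 ≤ (1 - ρ) / (1 + ρ) := div_nonneg (by linarith) (by linarith)
      have := mul_nonneg hc0.le this
      simpa using this) le_rfl
    simp only [ne_eq, OfNat.ofNat_ne_zero, not_false_eq_true, zero_pow, zero_mul, sub_zero,
        mul_zero, add_zero, one_mul] at hB
    refine le_trans ?_ hB
    have hW := growth_weight_le hr8 hr1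
    rw [mul_div_assoc, defect]
    have h6 := mul_nonneg (mul_nonneg hr0 (sub_nonneg.2 hc1)) (sub_nonneg.2 hW)
    linarith

end IsC3Pair

/-! ### Growth of univalent functions from lower bounds on the derivative -/

theorem isOpen_image_of_injOn {F : ℂ → ℂ} (hF : DifferentiableOn ℂ F disc) (hinj : InjOn F disc)
    {s : Set ℂ} (hs : s ⊆ disc) (hso : IsOpen s) : IsOpen (F '' s) := by
  rcases (hF.analyticOnNhd isOpen_disc).is_constant_or_isOpen isPreconnected_disc with h | h
  · obtain ⟨w, hw⟩ := h
    have h2 : ((1 / 2 : ℝ) : ℂ) ∈ disc := by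
      rw [mem_disc, norm_real, Real.norm_of_nonneg] <;> norm_num
    have := hinj h2 zero_mem_disc (by rw [hw _ h2, hw _ zero_mem_disc])
    norm_num at this
  · exact h s hs hso

/-- The image of a disc under a univalent function contains the disc whose radius is the least
modulus on the boundary circle. -/
theorem ball_subset_image_ball {F : ℂ → ℂ} (hF : DifferentiableOn ℂ F disc)
    (hinj : InjOn F disc) (hF0 : F 0 = 0) {R μ : ℝ} (hR0 : 0 < R) (hR1 : R < 1) (hμ : 0 < μ)
    (hle : ∀ z : ℂ, ‖z‖ = R → μ ≤ ‖F z‖) : ball 0 μ ⊆ F '' ball 0 R := by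
  have hsub : closedBall (0 : ℂ) R ⊆ disc := closedBall_subset_disc hR1
  have hcomp : IsCompact (F '' closedBall 0 R) :=
    (isCompact_closedBall 0 R).image_of_continuousOn (hF.continuousOn.mono hsub)
  refine (convex_ball (0 : ℂ) μ).isPreconnected.subset_left_of_subset_union
    (isOpen_image_of_injOn hF hinj (ball_subset_closedBall.trans hsub) isOpen_ball)
    hcomp.isClosed.isOpen_compl ?_ ?_ ?_
  · exact disjoint_compl_right.mono_left (image_mono ball_subset_closedBall)
  · intro w hw
    by_cases h : w ∈ F '' closedBall 0 R
    · left
      obtain ⟨z, hz, rfl⟩ := h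
      refine ⟨z, ?_, rfl⟩
      rw [mem_closedBall_zero_iff] at hz
      rw [mem_ball_zero_iff] at hw ⊢
      refine lt_of_le_of_ne hz fun h => ?_
      linarith [hle z h]
    · right; exact h
  · exact ⟨0, mem_ball_self hμ, 0, mem_ball_self hR0, hF0⟩

/-- A univalent function grows at least as fast as the integral of a lower bound for its
derivative. -/
theorem le_norm_of_le_norm_deriv {F : ℂ → ℂ} (hF : DifferentiableOn ℂ F disc)
    (hinj : InjOn F disc) (hF0 : F 0 = 0) {M N : ℝ → ℝ} (hM : ContinuousOn M (Ici 0))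
    (hle : ∀ z ∈ disc, z ≠ 0 → M ‖z‖ ≤ ‖deriv F z‖) (hN0 : N 0 = 0)
    (hN : ∀ r, 0 < r → r < 1 → HasDerivAt N (M r) r) (hNc : ContinuousOn N (Ico 0 1))
    {z : ℂ} (hz : z ∈ disc) : N ‖z‖ ≤ ‖F z‖ := by
  have hr1 := mem_disc.1 hz
  by_cases hz0 : z = 0
  · simp [hz0, hN0, hF0]
  set R := ‖z‖ with hR
  have hR0 : 0 < R := norm_pos_iff.2 hz0
  have hsub : closedBall (0 : ℂ) R ⊆ disc := closedBall_subset_disc hr1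
  -- M may be negative, as the defect term can be. The truncation at 0 keeps the bound usable after
  -- multiplication by a radial speed of unknown sign.
  set K : ℝ → ℝ := fun r => max (M |r|) 0 with hK
  have hKc : Continuous K := by
    have : Continuous fun r : ℝ => M |r| :=
      hM.comp_continuous continuous_abs fun r => abs_nonneg r
    exact this.max continuous_const
  set P : ℝ → ℝ := fun r => ∫ ρ in (0 : ℝ)..r, K ρ with hP
  have hPd : ∀ r, HasDerivAt P (K r) r := fun r => (hKc.integral_hasStrictDerivAt 0 r).hasDerivAt
  have hP0 : P 0 = 0 := by simp [hP]
  have hNP : N R ≤ P R := by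
    have hmono : MonotoneOn (fun r => P r - N r) (Icc 0 R) := by
      refine monotoneOn_of_deriv_nonneg (convex_Icc 0 R) ?_ ?_ ?_
      · refine ContinuousOn.sub (fun r _ => (hPd r).continuousAt.continuousWithinAt) ?_
        exact hNc.mono fun r hr => ⟨hr.1, hr.2.trans_lt hr1⟩
      · intro r hr
        rw [interior_Icc] at hr
        exact ((hPd r).sub (hN r hr.1 (hr.2.trans hr1))).differentiableAt.differentiableWithinAt
      · intro r hr
        rw [interior_Icc] at hr
        have h1 : deriv (fun r => P r - N r) r = K r - M r :=
          ((hPd r).sub (hN r hr.1 (hr.2.trans hr1))).deriv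
        rw [h1, hK]
        simp only [abs_of_pos hr.1]
        linarith [le_max_left (M r) 0]
    have := hmono (left_mem_Icc.2 hR0.le) (right_mem_Icc.2 hR0.le) hR0.le
    simp only [hP0, hN0] at this
    linarith
  refine hNP.trans ?_
  have hsph : (sphere (0 : ℂ) R).Nonempty := ⟨z, by simp [hR]⟩
  -- At a point of least modulus of F on the circle, the segment from 0 to F(z₁) stays inside the
  -- image and can be lifted.
  obtain ⟨z₁, hz₁, hmin⟩ := (isCompact_sphere (0 : ℂ) R).exists_isMinOn hsph
    ((hF.continuousOn.mono (sphere_subset_closedBall.trans hsub)).norm)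
  have hz₁R : ‖z₁‖ = R := by simpa using hz₁
  have hz₁d : z₁ ∈ disc := mem_disc.2 (by rw [hz₁R]; exact hr1)
  have hz₁0 : z₁ ≠ 0 := norm_pos_iff.1 (by rw [hz₁R]; exact hR0)
  set μ := ‖F z₁‖ with hμ
  have hFz₁ : F z₁ ≠ 0 := fun h => hz₁0 (hinj hz₁d zero_mem_disc (by rw [h, hF0]))
  have hμ0 : 0 < μ := norm_pos_iff.2 hFz₁
  have hμle : ∀ w : ℂ, ‖w‖ = R → μ ≤ ‖F w‖ := fun w hw => hmin (by simpa using hw)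
  refine le_trans ?_ (hμle z rfl)
  have hball := ball_subset_image_ball hF hinj hF0 hR0 hr1 hμ0 hμle
  set c : ℝ → ℂ := fun t => Function.invFunOn F disc (t * F z₁) with hc
  have himg : ∀ t ∈ Icc (0 : ℝ) 1, ∃ y ∈ disc, F y = t * F z₁ := by
    intro t ht
    rcases ht.2.eq_or_lt with h | h
    · exact ⟨z₁, hz₁d, by rw [h]; simp⟩
    · have : (t : ℂ) * F z₁ ∈ ball (0 : ℂ) μ := by
        rw [mem_ball_zero_iff, norm_mul, norm_real, Real.norm_of_nonneg ht.1]
        nlinarith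
      obtain ⟨y, hy, hy2⟩ := hball this
      exact ⟨y, hsub (ball_subset_closedBall hy), hy2⟩
  have hcF : ∀ t ∈ Icc (0 : ℝ) 1, c t ∈ disc ∧ F (c t) = t * F z₁ := by
    intro t ht
    obtain ⟨y, hy, hy2⟩ := himg t ht
    have hm : (t : ℂ) * F z₁ ∈ F '' disc := ⟨y, hy, hy2⟩
    exact ⟨Function.invFunOn_mem hm, Function.invFunOn_eq hm⟩
  have hc0 : c 0 = 0 := by
    have := hcF 0 (by simp)
    exact hinj this.1 zero_mem_disc (by rw [this.2, hF0]; simp)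
  have hc1 : c 1 = z₁ := by
    have := hcF 1 (by simp)
    exact hinj this.1 hz₁d (by rw [this.2]; simp)
  have hcd : ∀ t ∈ Icc (0 : ℝ) 1, HasDerivAt c ((deriv F (c t))⁻¹ * F z₁) t := by
    intro t ht
    have h1 := hasDerivAt_invFunOn isOpen_disc hF hinj (hcF t ht).1
    rw [(hcF t ht).2] at h1
    have h2 : HasDerivAt (fun t : ℝ => (t : ℂ) * F z₁) (F z₁) t := by
      simpa using (hasDerivAt_id t).ofReal_comp.mul_const (F z₁)
    exact h1.comp t h2
  -- Along the lift c of the segment, |F'(c)||c'| = μ, so P(|c|) grows at rate at most K(|c|)|c'| ≤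
  -- μ. Comparing t = 0 and t = 1 gives P(R) ≤ μ.
  have hmono : MonotoneOn (fun t => t * μ - P ‖c t‖) (Icc 0 1) := by
    have hPc : Continuous P := continuous_iff_continuousAt.2 fun r => (hPd r).continuousAt
    have hder : ∀ t ∈ Ioo (0 : ℝ) 1, HasDerivAt (fun t => t * μ - P ‖c t‖)
        (μ - K ‖c t‖ * (‖c t‖ * ((deriv F (c t))⁻¹ * F z₁ / c t).re)) t := by
      intro t ht
      have ht' := Ioo_subset_Icc_self ht
      have hne : c t ≠ 0 := by
        intro h
        have h2 := (hcF t ht').2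
        rw [h, hF0] at h2
        have : (t : ℂ) ≠ 0 := by exact_mod_cast ht.1.ne'
        exact mul_ne_zero this hFz₁ h2.symm
      have h1 := hasDerivAt_norm_curve (hcd t ht') hne
      have h2 : HasDerivAt (fun t => P ‖c t‖)
          (K ‖c t‖ * (‖c t‖ * ((deriv F (c t))⁻¹ * F z₁ / c t).re)) t :=
        HasDerivAt.comp (h₂ := P) t (hPd ‖c t‖) h1
      have h3 : HasDerivAt (fun t => t * μ) μ t := by
        simpa using (hasDerivAt_id t).mul_const μ
      exact h3.sub h2
    refine monotoneOn_of_deriv_nonneg (convex_Icc 0 1) ?_ ?_ ?_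
    · refine (continuousOn_id.mul continuousOn_const).sub (hPc.comp_continuousOn ?_)
      exact ContinuousOn.norm fun t ht => (hcd t ht).continuousAt.continuousWithinAt
    · intro t ht
      rw [interior_Icc] at ht
      exact (hder t ht).differentiableAt.differentiableWithinAt
    · intro t ht
      rw [interior_Icc] at ht
      rw [(hder t ht).deriv]
      have ht' := Ioo_subset_Icc_self ht
      have hct := (hcF t ht').1
      have hne : c t ≠ 0 := by
        intro h
        have h2 := (hcF t ht').2
        rw [h, hF0] at h2
        have : (t : ℂ) ≠ 0 := by exact_mod_cast ht.1.ne'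
        exact mul_ne_zero this hFz₁ h2.symm
      have hFd : 0 < ‖deriv F (c t)‖ :=
        norm_pos_iff.2 (deriv_ne_zero_of_injOn isOpen_disc hF hinj hct)
      have hKle : K ‖c t‖ ≤ ‖deriv F (c t)‖ := by
        simp only [hK, abs_norm]
        exact max_le (hle _ hct hne) hFd.le
      have hK0 : 0 ≤ K ‖c t‖ := le_max_right _ _
      have h4 : ‖c t‖ * ((deriv F (c t))⁻¹ * F z₁ / c t).re ≤ μ / ‖deriv F (c t)‖ := by
        refine (mul_le_mul_of_nonneg_left (re_le_norm _) (norm_nonneg _)).trans (le_of_eq ?_)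
        have := norm_ne_zero_iff.2 hne
        rw [norm_div, norm_mul, norm_inv]
        field_simp
        exact hμ.symm
      have h5 := mul_le_mul_of_nonneg_left h4 hK0
      have h6 : K ‖c t‖ * (μ / ‖deriv F (c t)‖) ≤ μ := by
        rw [← mul_div_assoc, div_le_iff₀ hFd, mul_comm μ]
        exact mul_le_mul_of_nonneg_right hKle hμ0.le
      linarith
  have := hmono (left_mem_Icc.2 zero_le_one) (right_mem_Icc.2 zero_le_one) zero_le_one
  simp only [hc0, hc1, hz₁R, norm_zero, hP0] at this
  linarith

/-! ### Univalence of the class 𝒞₃ -/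

/-- If `Re (F' / g') > 0` with `g` convex, then the difference quotients of `F` with respect to `g`
have positive real part. -/
theorem IsConvexFunction.re_sub_div_sub_pos {g F : ℂ → ℂ} (hg : IsConvexFunction g)
    (hF : DifferentiableOn ℂ F disc) (hpos : ∀ z ∈ disc, 0 < (deriv F z / deriv g z).re)
    {y z : ℂ} (hy : y ∈ disc) (hz : z ∈ disc) (hne : y ≠ z) :
    0 < ((F z - F y) / (g z - g y)).re := by
  set w := g z - g y with hw
  have hw0 : w ≠ 0 := sub_ne_zero.2 fun h => hne (hg.univalent hy hz h.symm)
  set c : ℝ → ℂ := fun t => Function.invFunOn g disc (g y + t * w) with hc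
  have hcg : ∀ t ∈ Icc (0 : ℝ) 1, c t ∈ disc ∧ g (c t) = g y + t * w := by
    intro t ht
    have hm : g y + t * w ∈ g '' disc := by
      have := hg.convex_image (mem_image_of_mem g hy) (mem_image_of_mem g hz)
        (a := 1 - t) (b := t) (by linarith [ht.2]) ht.1 (by ring)
      have e : (1 - t) • g y + t • g z = g y + t * w := by
        simp only [real_smul, hw]; push_cast; ring
      rwa [e] at this
    exact ⟨Function.invFunOn_mem hm, Function.invFunOn_eq hm⟩
  have hc0 : c 0 = y := by
    have := hcg 0 (by simp)
    exact hg.univalent this.1 hy (by rw [this.2]; simp)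
  have hc1 : c 1 = z := by
    have := hcg 1 (by simp)
    exact hg.univalent this.1 hz (by rw [this.2, hw]; simp)
  have hder : ∀ t ∈ Icc (0 : ℝ) 1, HasDerivAt (fun t => (F (c t) / w).re)
      (deriv F (c t) / deriv g (c t)).re t := by
    intro t ht
    have h1 := hasDerivAt_invFunOn isOpen_disc hg.analytic hg.univalent (hcg t ht).1
    rw [(hcg t ht).2] at h1
    have h2 : HasDerivAt (fun t : ℝ => g y + (t : ℂ) * w) w t := by
      simpa using ((hasDerivAt_id t).ofReal_comp.mul_const w).const_add (g y)
    have h3 : HasDerivAt c ((deriv g (c t))⁻¹ * w) t :=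
      HasDerivAt.comp (h₂ := Function.invFunOn g disc) t h1 h2
    have h4 : HasDerivAt (fun t => F (c t)) (deriv F (c t) * ((deriv g (c t))⁻¹ * w)) t :=
      (hF.differentiableAt (disc_mem_nhds (hcg t ht).1)).hasDerivAt.comp t h3
    have h5 := h4.div_const w
    have h6 : deriv F (c t) * ((deriv g (c t))⁻¹ * w) / w = deriv F (c t) / deriv g (c t) := by
      field_simp
    rw [h6] at h5
    exact reCLM.hasFDerivAt.comp_hasDerivAt t h5
  -- Along the lift by g of the segment from g(y) to g(z), Re(F/w) has derivative Re(F'/g'). The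
  -- mean value theorem identifies the quotient with one such value.
  obtain ⟨t, ht, hslope⟩ := exists_hasDerivAt_eq_slope _ _ (zero_lt_one (α := ℝ))
    (fun t ht => (hder t ht).continuousAt.continuousWithinAt)
    (fun t ht => hder t (Ioo_subset_Icc_self ht))
  have := hpos _ (hcg t (Ioo_subset_Icc_self ht)).1
  rw [hslope, hc0, hc1, sub_zero, div_one, ← sub_re, ← sub_div] at this
  exact this

/-- The logarithmic primitive `∫ g(z) / z dz` of a function vanishing at the origin. -/
theorem exists_log_primitive {g : ℂ → ℂ} (hg : DifferentiableOn ℂ g disc) (hg0 : g 0 = 0) :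
    ∃ G : ℂ → ℂ, DifferentiableOn ℂ G disc ∧ G 0 = 0 ∧ deriv G 0 = deriv g 0 ∧
      ∀ z ∈ disc, z * deriv G z = g z := by
  have hd : DifferentiableOn ℂ (dslope g 0) disc :=
    (differentiableOn_dslope (disc_mem_nhds zero_mem_disc)).2 hg
  obtain ⟨G, hG0, hG⟩ := (DifferentiableOn.isExactOn_ball (c := 0) (r := 1) hd).with_val_at 0 0
  refine ⟨G, fun z hz => (hG z hz).differentiableAt.differentiableWithinAt, hG0, ?_, ?_⟩
  · rw [(hG 0 zero_mem_disc).deriv, dslope_same]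
  · intro z hz
    rw [(hG z hz).deriv]
    have := sub_smul_dslope g 0 z
    simpa [hg0] using this

theorem differentiableOn_sub_comp_mul {F : ℂ → ℂ} (hF : DifferentiableOn ℂ F disc) {x : ℂ}
    (hx : ‖x‖ ≤ 1) : DifferentiableOn ℂ (fun w => F w - F (x * w)) disc :=
  hF.sub (hF.comp (differentiableOn_id.const_mul x) fun _ hw => mul_mem_disc hx hw)

theorem deriv_sub_comp_mul {F : ℂ → ℂ} (hF : DifferentiableOn ℂ F disc) {x z : ℂ}
    (hx : ‖x‖ ≤ 1) (hz : z ∈ disc) :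
    deriv (fun w => F w - F (x * w)) z = deriv F z - x * deriv F (x * z) := by
  have h1 := (hF.differentiableAt (disc_mem_nhds hz)).hasDerivAt
  have h2 := (hF.differentiableAt (disc_mem_nhds (mul_mem_disc hx hz))).hasDerivAt
  have h3 : HasDerivAt (fun w => F (x * w)) (deriv F (x * z) * (x * 1)) z :=
    HasDerivAt.comp (h₂ := F) z h2 ((hasDerivAt_id z).const_mul x)
  have h4 := (h1.sub h3).deriv
  rw [mul_one, mul_comm _ x] at h4
  exact h4

namespace IsC3Pair

variable {f g : ℂ → ℂ}

/-- Positivity for (z(zf')')'/(zg')' passes to z(zf')'/(zg') because zg' is starlike. The factor z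
cancels, so zf' is close-to-convex with respect to g. -/
theorem re_deriv_zDeriv_div_deriv_pos (h : IsC3Pair f g) {z : ℂ} (hz : z ∈ disc) :
    0 < (deriv (zDeriv f) z / deriv g z).re := by
  by_cases hz0 : z = 0
  · rw [hz0, deriv_zDeriv_zero h.analytic, h.deriv_zero, one_div]
    exact inv_re_pos h.convex.re_deriv_zero_pos
  · have h1 := re_div_pos_of_re_deriv_div_pos h.analytic_g h.analytic_two (zDeriv_zero _)
      (zDeriv_zero _) (fun w hw hw0 => h.re_zDeriv_div_pos hw hw0) h.re_pos hz hz0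
    rwa [zDeriv, zDeriv.eq_def g, mul_div_mul_left _ _ hz0] at h1

theorem re_zDeriv_sub_div_pos (h : IsC3Pair f g) {y z : ℂ} (hy : y ∈ disc) (hz : z ∈ disc)
    (hne : y ≠ z) : 0 < ((zDeriv f z - zDeriv f y) / (g z - g y)).re :=
  h.convex.re_sub_div_sub_pos h.analytic_one (fun _ hw => h.re_deriv_zDeriv_div_deriv_pos hw)
    hy hz hne

theorem injOn_zDeriv (h : IsC3Pair f g) : InjOn (zDeriv f) disc := by
  intro y hy z hz hyz
  by_contra hne
  have := h.re_zDeriv_sub_div_pos hy hz hne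
  simp [hyz] at this

/-- Functions in `𝒞₃` are univalent. -/
theorem injOn (h : IsC3Pair f g) : InjOn f disc := by
  suffices H : ∀ y ∈ disc, ∀ z ∈ disc, ‖y‖ ≤ ‖z‖ → y ≠ z → f z ≠ f y by
    intro y hy z hz hyz
    by_contra hne
    rcases le_total ‖y‖ ‖z‖ with hle | hle
    · exact H y hy z hz hle hne hyz.symm
    · exact H z hz y hy hle (Ne.symm hne) hyz
  intro y hy z hz hyz hne
  have hz0 : z ≠ 0 := by
    rintro rfl
    exact hne (norm_eq_zero.1 (le_antisymm (by simpa using hyz) (norm_nonneg _)))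
  -- Two points with |y| ≤ |z| become z and xz with |x| ≤ 1, so holomorphy in the variable w can be
  -- used for w ↦ f(w) - f(xw).
  set x := y / z with hxdef
  have hx : ‖x‖ ≤ 1 := by
    rw [hxdef, norm_div]; exact div_le_one_of_le₀ hyz (norm_nonneg _)
  have hx1 : x ≠ 1 := fun h => hne ((div_eq_one_iff_eq hz0).1 h)
  have hxz : x * z = y := div_mul_cancel₀ _ hz0
  have hxw : ∀ w : ℂ, w ≠ 0 → x * w ≠ w := fun w hw h' =>
    hx1 (mul_right_cancel₀ hw (by rw [h', one_mul]))
  have hxn : ∀ w : ℂ, ‖x * w‖ ≤ ‖w‖ := fun w => by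
    rw [norm_mul]; exact mul_le_of_le_one_left (norm_nonneg _) hx
  have h1x : 1 - x ≠ 0 := sub_ne_zero.2 hx1.symm
  obtain ⟨G, hGd, hG0, hG'0, hG⟩ := exists_log_primitive h.convex.analytic h.convex.map_zero
  have hg' := h.convex.deriv_ne_zero zero_mem_disc
  have hgd := differentiableOn_sub_comp_mul h.convex.analytic hx
  have hGxd := differentiableOn_sub_comp_mul hGd hx
  have hfd := differentiableOn_sub_comp_mul h.analytic hx
  have hgx' : ∀ w ∈ disc, w * deriv (fun w => g w - g (x * w)) w =
      zDeriv g w - zDeriv g (x * w) := by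
    intro w hw
    rw [deriv_sub_comp_mul h.convex.analytic hx hw, zDeriv, zDeriv]; ring
  have hfx' : ∀ w ∈ disc, w * deriv (fun w => f w - f (x * w)) w =
      zDeriv f w - zDeriv f (x * w) := by
    intro w hw
    rw [deriv_sub_comp_mul h.analytic hx hw, zDeriv, zDeriv]; ring
  have hGx' : ∀ w ∈ disc, w * deriv (fun w => G w - G (x * w)) w = g w - g (x * w) := by
    intro w hw
    rw [deriv_sub_comp_mul hGd hx hw, ← hG w hw, ← hG _ (mul_mem_disc hx hw)]; ring
  have hstg : ∀ w ∈ disc, w ≠ 0 →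
      0 < ((g w - g (x * w)) / (w * deriv (fun w => g w - g (x * w)) w)).re := by
    intro w hw hw0
    rw [hgx' w hw]
    exact div_re_pos_symm (h.convex.re_zDeriv_sub_div_pos hw (hxn w) (hxw w hw0))
  -- The function G(w) - G(xw) is starlike: w times its derivative is g(w) - g(xw), and positivity
  -- of its derivative quotient with that function is exactly the starlikeness of g(w) - g(xw).
  have key1 : ∀ w ∈ disc, w ≠ 0 → 0 < ((G w - G (x * w)) / (g w - g (x * w))).re := by
    intro w hw hw0
    refine re_div_pos_of_re_deriv_div_pos hgd hGxd (by simp) (by simp) hstg ?_ hw hw0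
    intro v hv
    by_cases hv0 : v = 0
    · rw [hv0, deriv_sub_comp_mul hGd hx zero_mem_disc,
        deriv_sub_comp_mul h.convex.analytic hx zero_mem_disc, mul_zero, hG'0, div_self]
      · simp
      · have : deriv g 0 - x * deriv g 0 = (1 - x) * deriv g 0 := by ring
        rw [this]; exact mul_ne_zero h1x hg'
    · rw [← mul_div_mul_left _ _ hv0, hGx' v hv]
      exact hstg v hv hv0
  -- The derivatives of f(w) - f(xw) and G(w) - G(xw) have quotient (zf'(w) - zf'(xw))/(g(w) -
  -- g(xw)), where zf' stands for `zDeriv f`. Its real part is positive by close-to-convexity.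
  have key2 := re_div_pos_of_re_deriv_div_pos hGxd hfd (by simp) (by simp)
    (fun w hw hw0 => by rw [hGx' w hw]; exact key1 w hw hw0) (by
      intro v hv
      by_cases hv0 : v = 0
      · rw [hv0, deriv_sub_comp_mul hGd hx zero_mem_disc,
          deriv_sub_comp_mul h.analytic hx zero_mem_disc, mul_zero, hG'0, h.deriv_zero]
        have : (1 - x * 1) / (deriv g 0 - x * deriv g 0) = (deriv g 0)⁻¹ := by
          have : deriv g 0 - x * deriv g 0 = (1 - x) * deriv g 0 := by ring
          rw [this, mul_one]; field_simp
        rw [this]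
        exact inv_re_pos h.convex.re_deriv_zero_pos
      · rw [← mul_div_mul_left _ _ hv0, hGx' v hv, hfx' v hv]
        exact h.re_zDeriv_sub_div_pos (mul_mem_disc hx hv) hv (hxw v hv0)) hz hz0
  intro heq
  simp [hxz, heq] at key2

end IsC3Pair

/-! ### Taylor coefficients and their sharp bounds -/

theorem hasSum_taylorCoeff {f : ℂ → ℂ} (hf : DifferentiableOn ℂ f disc) {z : ℂ} (hz : z ∈ disc) :
    HasSum (fun n => taylorCoeff f n * z ^ n) (f z) := by
  have := hasSum_taylorSeries_on_ball (c := 0) (r := 1) hf hz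
  refine this.congr_fun fun n => ?_
  simp only [taylorCoeff, sub_zero, smul_eq_mul]
  ring

theorem taylorCoeff_congr {f g : ℂ → ℂ} (h : ∀ z ∈ disc, f z = g z) (n : ℕ) :
    taylorCoeff f n = taylorCoeff g n := by
  have h1 : f =ᶠ[𝓝 0] g := by
    filter_upwards [disc_mem_nhds zero_mem_disc] with z hz using h z hz
  rw [taylorCoeff, taylorCoeff, h1.iteratedDeriv_eq]

theorem taylorCoeff_zero (f : ℂ → ℂ) : taylorCoeff f 0 = f 0 := by simp [taylorCoeff]

theorem taylorCoeff_one (f : ℂ → ℂ) : taylorCoeff f 1 = deriv f 0 := by simp [taylorCoeff]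

theorem taylorCoeff_eq_coeff {f : ℂ → ℂ} {p : FormalMultilinearSeries ℂ ℂ ℂ} {r : ENNReal}
    (h : HasFPowerSeriesOnBall f p 0 r) (n : ℕ) : taylorCoeff f n = p n fun _ => 1 := by
  have h1 := h.factorial_smul (y := 1) n
  rw [taylorCoeff, iteratedDeriv_eq_iteratedFDeriv, ← h1, nsmul_eq_mul]
  exact mul_div_cancel_left₀ _ (by exact_mod_cast n.factorial_ne_zero)

theorem taylorCoeff_eq_of_hasSum {f : ℂ → ℂ} {a : ℕ → ℂ}
    (h : ∀ z ∈ disc, HasSum (fun n => a n * z ^ n) (f z)) (n : ℕ) : taylorCoeff f n = a n := by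
  have hfp : HasFPowerSeriesOnBall f (FormalMultilinearSeries.ofScalars ℂ a) 0
      ((1 / 2 : NNReal) : ENNReal) := by
    refine ⟨?_, by simp, fun {y} hy => ?_⟩
    · refine FormalMultilinearSeries.le_radius_of_summable_norm _ ?_
      have h2 : ((1 / 2 : ℝ) : ℂ) ∈ disc := by
        rw [mem_disc, norm_real, Real.norm_of_nonneg] <;> norm_num
      have h3 := (h _ h2).summable.norm
      refine Summable.of_nonneg_of_le (fun n => by positivity) (fun n => ?_) h3
      rw [norm_mul, norm_pow, norm_real, Real.norm_of_nonneg (by norm_num)]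
      refine mul_le_mul (le_of_eq ?_) (le_of_eq ?_) (by positivity) (norm_nonneg _)
      · exact FormalMultilinearSeries.ofScalars_norm ℂ a n
      · norm_num
    · have hy' : y ∈ disc := by
        rw [mem_eball_zero_iff] at hy
        rw [mem_disc]
        have h4 : ‖y‖₊ < 1 / 2 := by exact_mod_cast hy
        have h5 : (‖y‖₊ : ℝ) < (1 / 2 : NNReal) := NNReal.coe_lt_coe.2 h4
        rw [coe_nnnorm] at h5
        refine h5.trans ?_
        norm_num
      simpa [FormalMultilinearSeries.ofScalars_apply_eq, mul_comm] using h y hy'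
  rw [taylorCoeff_eq_coeff hfp, FormalMultilinearSeries.ofScalars_apply_eq]
  simp

theorem taylorCoeff_deriv (f : ℂ → ℂ) (n : ℕ) :
    taylorCoeff (deriv f) n = (n + 1) * taylorCoeff f (n + 1) := by
  rw [taylorCoeff, taylorCoeff, iteratedDeriv_succ', Nat.factorial_succ]
  have h1 : (n.factorial : ℂ) ≠ 0 := by exact_mod_cast n.factorial_ne_zero
  have h2 : (n : ℂ) + 1 ≠ 0 := by exact_mod_cast n.succ_ne_zero
  push_cast
  field_simp

theorem taylorCoeff_mul {f g : ℂ → ℂ} (hf : DifferentiableOn ℂ f disc)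
    (hg : DifferentiableOn ℂ g disc) (n : ℕ) :
    taylorCoeff (fun z => f z * g z) n =
      ∑ i ∈ Finset.range (n + 1), taylorCoeff f (n - i) * taylorCoeff g i := by
  have hfa := (hf.analyticAt (disc_mem_nhds zero_mem_disc)).contDiffAt (n := n)
  have hga := (hg.analyticAt (disc_mem_nhds zero_mem_disc)).contDiffAt (n := n)
  have h := iteratedDeriv_fun_mul hga hfa
  have hcomm : (fun z => f z * g z) = fun z => g z * f z := by funext z; ring
  rw [taylorCoeff, hcomm, h, Finset.sum_div]
  refine Finset.sum_congr rfl fun i hi => ?_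
  have hin : i ≤ n := Nat.lt_succ_iff.1 (Finset.mem_range.1 hi)
  rw [taylorCoeff, taylorCoeff, Nat.cast_choose ℂ hin]
  have h1 : (n.factorial : ℂ) ≠ 0 := by exact_mod_cast n.factorial_ne_zero
  have h2 : (i.factorial : ℂ) ≠ 0 := by exact_mod_cast i.factorial_ne_zero
  have h3 : ((n - i).factorial : ℂ) ≠ 0 := by exact_mod_cast (n - i).factorial_ne_zero
  field_simp

theorem taylorCoeff_zDeriv {f : ℂ → ℂ} (hf : DifferentiableOn ℂ f disc) (n : ℕ) :
    taylorCoeff (zDeriv f) n = n * taylorCoeff f n := by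
  refine taylorCoeff_eq_of_hasSum (a := fun n => n * taylorCoeff f n) (fun z hz => ?_) n
  have h1 := (hasSum_taylorCoeff (hf.deriv isOpen_disc) hz).mul_left z
  rw [← hasSum_nat_add_iff' 1]
  simp only [Finset.range_one, Finset.sum_singleton, Nat.cast_zero, zero_mul, sub_zero]
  refine h1.congr_fun fun n => ?_
  rw [taylorCoeff_deriv]
  push_cast
  ring

/-- Carathéodory's coefficient bound. -/
theorem norm_taylorCoeff_le_of_re_pos {p : ℂ → ℂ} (hp : DifferentiableOn ℂ p disc)
    (hpos : ∀ z ∈ disc, 0 < (p z).re) {n : ℕ} (hn : n ≠ 0) :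
    ‖taylorCoeff p n‖ ≤ 2 * (p 0).re := by
  have key : ∀ r : ℝ, 0 < r → r < 1 → ‖taylorCoeff p n‖ * r ^ n ≤ 2 * (p 0).re := by
    intro r hr0 hr1
    have hsub : closedBall (0 : ℂ) r ⊆ disc := closedBall_subset_disc hr1
    have hsph : sphere (0 : ℂ) |r| ⊆ disc := by
      rw [abs_of_pos hr0]; exact sphere_subset_closedBall.trans hsub
    have hne : ∀ z ∈ sphere (0 : ℂ) |r|, z ≠ 0 := fun z hz =>
      ne_of_mem_sphere hz (abs_pos.2 hr0.ne').ne'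
    have hpc : ContinuousOn p (sphere (0 : ℂ) |r|) := hp.continuousOn.mono hsph
    have hWc : ContinuousOn (fun z : ℂ => (z ^ n)⁻¹) (sphere (0 : ℂ) |r|) :=
      (continuousOn_id.pow n).inv₀ fun z hz => pow_ne_zero n (hne z hz)
    have hconjc : ContinuousOn (fun z => (starRingEnd ℂ) (p z)) (sphere (0 : ℂ) |r|) :=
      continuous_conj.comp_continuousOn hpc
    have h1 : taylorCoeff p n = Real.circleAverage (fun z => (z ^ n)⁻¹ * p z) 0 r := by
      have hfp := DifferentiableOn.hasFPowerSeriesOnBall (R := ⟨r, hr0.le⟩) (c := 0) (f := p)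
        (hp.mono hsub) hr0
      rw [taylorCoeff_eq_coeff hfp, cauchyPowerSeries_apply,
        Real.circleAverage_eq_circleIntegral hr0.ne']
      congr 1
      refine circleIntegral.integral_congr hr0.le fun z hz => ?_
      simp only [sub_zero, smul_eq_mul, one_div, inv_pow]
      ring
    have h2 : Real.circleAverage (fun z => z ^ n * p z) 0 r = 0 := by
      have hd : DiffContOnCl ℂ (fun z => z ^ n * p z) (ball 0 |r|) := by
        refine DifferentiableOn.diffContOnCl ?_
        rw [abs_of_pos hr0, closure_ball _ hr0.ne']
        exact (differentiableOn_id.pow n).mul (hp.mono hsub)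
      rw [hd.circleAverage]
      simp [hn]
    -- On |z| = r one has conj z = r²/z, so this average is a multiple of the conjugate of the
    -- vanishing mean of zⁿp. Adding it to the coefficient formula replaces p by 2 Re p.
    have h3 : Real.circleAverage (fun z => (z ^ n)⁻¹ * (starRingEnd ℂ) (p z)) 0 r = 0 := by
      have hci : CircleIntegrable (fun z => z ^ n * p z) 0 r :=
        ContinuousOn.circleIntegrable' ((continuousOn_id.pow n).mul hpc)
      have h4 := (conjCLE : ℂ →L[ℝ] ℂ).circleAverage_comp_comm hci
      rw [h2, map_zero] at h4
      have h5 : Real.circleAverage (fun z => (z ^ n)⁻¹ * (starRingEnd ℂ) (p z)) 0 r =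
          Real.circleAverage (fun z => ((r ^ (2 * n))⁻¹ : ℝ) •
            ((conjCLE : ℂ →L[ℝ] ℂ) ∘ fun z => z ^ n * p z) z) 0 r := by
        refine Real.circleAverage_congr_sphere fun z hz => ?_
        have hz0 := hne z hz
        have hzr : (starRingEnd ℂ) z * z = (r : ℂ) ^ 2 := by
          rw [← normSq_eq_conj_mul_self, normSq_eq_norm_sq]
          rw [mem_sphere_zero_iff_norm, abs_of_pos hr0] at hz
          rw [hz]; push_cast; rfl
        simp only [Function.comp, real_smul, ContinuousLinearEquiv.coe_coe, conjCLE_apply, map_mul,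
          map_pow]
        have hr : (r : ℂ) ≠ 0 := by exact_mod_cast hr0.ne'
        have h6 : (r : ℂ) ^ (2 * n) = (starRingEnd ℂ) z ^ n * z ^ n := by
          rw [← mul_pow, hzr, ← pow_mul]
        have hz' : (starRingEnd ℂ) z ≠ 0 := (map_ne_zero _).2 hz0
        push_cast
        rw [h6]
        field_simp
      rw [h5, Real.circleAverage_fun_smul, h4, smul_zero]
    have hi1 : CircleIntegrable (fun z => (z ^ n)⁻¹ * p z) 0 r :=
      ContinuousOn.circleIntegrable' (hWc.mul hpc)
    have hi2 : CircleIntegrable (fun z => (z ^ n)⁻¹ * (starRingEnd ℂ) (p z)) 0 r :=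
      ContinuousOn.circleIntegrable' (hWc.mul hconjc)
    have h7 := Real.circleAverage_fun_add hi1 hi2
    rw [h3, add_zero, ← h1] at h7
    have hre : Real.circleAverage (fun z => (p z).re) 0 r = (p 0).re := by
      have hci : CircleIntegrable p 0 r := ContinuousOn.circleIntegrable' hpc
      have h8 := reCLM.circleAverage_comp_comm hci
      have hd : DiffContOnCl ℂ p (ball 0 |r|) := by
        refine DifferentiableOn.diffContOnCl ?_
        rw [abs_of_pos hr0, closure_ball _ hr0.ne']
        exact hp.mono hsub
      rw [hd.circleAverage] at h8
      exact h8
    have h9 : ‖taylorCoeff p n‖ ≤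
        Real.circleAverage (fun z => (2 * (r ^ n)⁻¹) • (p z).re) 0 r := by
      rw [← h7, Real.circleAverage_def, Real.circleAverage_def, norm_smul,
        Real.norm_of_nonneg (by positivity), smul_eq_mul]
      refine mul_le_mul_of_nonneg_left ?_ (by positivity)
      refine (intervalIntegral.norm_integral_le_integral_norm (by positivity)).trans (le_of_eq ?_)
      refine intervalIntegral.integral_congr fun θ _ => ?_
      have hm : circleMap 0 r θ ∈ disc := hsph (by simp)
      have hrp := hpos _ hm
      rw [← mul_add, add_conj, norm_mul, norm_inv, norm_pow, norm_circleMap_zero, norm_real,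
        Real.norm_of_nonneg (by positivity), abs_of_pos hr0, smul_eq_mul]
      ring
    rw [Real.circleAverage_fun_smul, hre, smul_eq_mul] at h9
    have hrn : 0 < r ^ n := by positivity
    calc ‖taylorCoeff p n‖ * r ^ n ≤ 2 * (r ^ n)⁻¹ * (p 0).re * r ^ n :=
          mul_le_mul_of_nonneg_right h9 hrn.le
      _ = 2 * (p 0).re := by field_simp
  have hlim : Tendsto (fun r : ℝ => ‖taylorCoeff p n‖ * r ^ n) (𝓝[<] 1)
      (𝓝 (‖taylorCoeff p n‖ * 1 ^ n)) :=
    ((continuous_const.mul (continuous_pow n)).tendsto 1).mono_left nhdsWithin_le_nhds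
  rw [one_pow, mul_one] at hlim
  refine le_of_tendsto hlim ?_
  filter_upwards [Ioo_mem_nhdsLT (zero_lt_one (α := ℝ))] with r hr using key r hr.1 hr.2

/-- Comparing coefficients in (zg')' = Q g' with Q(0) = 1 gives n(n + 1)bₙ₊₁ as the sum over i < n
of Qₙ₋ᵢ(i + 1)bᵢ₊₁. With |Qⱼ| ≤ 2 and induction, the sum is at most n(n + 1)|b₁|. -/
theorem IsConvexFunction.norm_taylorCoeff_le {g : ℂ → ℂ} (hg : IsConvexFunction g) (n : ℕ) :
    ‖taylorCoeff g (n + 1)‖ ≤ ‖deriv g 0‖ := by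
  set Q : ℂ → ℂ := fun z => deriv (zDeriv g) z / deriv g z with hQ
  have hgd := differentiableOn_zDeriv hg.analytic
  induction n using Nat.strong_induction_on with
  | _ n ih =>
    rcases Nat.eq_zero_or_pos n with rfl | hn
    · rw [taylorCoeff_one]
    have h1 : taylorCoeff (deriv (zDeriv g)) n =
        taylorCoeff (fun z => Q z * deriv g z) n :=
      taylorCoeff_congr (fun z hz => (div_mul_cancel₀ _ (hg.deriv_ne_zero hz)).symm) n
    rw [taylorCoeff_mul hg.differentiableOn_deriv_zDeriv_div (hg.analytic.deriv isOpen_disc),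
      Finset.sum_range_succ, taylorCoeff_deriv, taylorCoeff_zDeriv hg.analytic, Nat.sub_self,
      taylorCoeff_zero, hg.deriv_zDeriv_div_zero] at h1
    simp only [one_mul, taylorCoeff_deriv] at h1
    change _ = ∑ i ∈ Finset.range n, taylorCoeff Q (n - i) * _ + _ at h1
    have h2 : (n : ℂ) * (n + 1) * taylorCoeff g (n + 1) = ∑ i ∈ Finset.range n,
        taylorCoeff Q (n - i) * ((i + 1) * taylorCoeff g (i + 1)) := by
      rw [← sub_eq_iff_eq_add] at h1
      rw [← h1]; push_cast; ring
    have h3 : ‖∑ i ∈ Finset.range n, taylorCoeff Q (n - i) * ((i + 1) * taylorCoeff g (i + 1))‖ ≤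
        ∑ i ∈ Finset.range n, 2 * ((i + 1 : ℝ) * ‖deriv g 0‖) := by
      refine (norm_sum_le _ _).trans (Finset.sum_le_sum fun i hi => ?_)
      have hin := Finset.mem_range.1 hi
      rw [norm_mul, norm_mul]
      have h4 := norm_taylorCoeff_le_of_re_pos hg.differentiableOn_deriv_zDeriv_div
        (fun z hz => hg.re_deriv_zDeriv_div_pos hz) (n := n - i) (by omega)
      rw [hg.deriv_zDeriv_div_zero, one_re, mul_one] at h4
      have h5 : ‖(i : ℂ) + 1‖ = i + 1 := by
        rw [← Nat.cast_succ, norm_natCast]; push_cast; ring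
      rw [h5]
      exact mul_le_mul h4 (mul_le_mul_of_nonneg_left (ih i hin) (by positivity)) (by positivity)
        (by norm_num)
    have h6 : ∀ m : ℕ, ∑ i ∈ Finset.range m, 2 * ((i + 1 : ℝ) * ‖deriv g 0‖) =
        m * (m + 1) * ‖deriv g 0‖ := by
      intro m
      induction m with
      | zero => simp
      | succ m ihm => rw [Finset.sum_range_succ, ihm]; push_cast; ring
    rw [← h2, h6, norm_mul, norm_mul, norm_natCast, ← Nat.cast_succ, norm_natCast,
      Nat.cast_succ] at h3
    exact le_of_mul_le_mul_left h3 (by positivity)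

/-- The Taylor coefficients of the extremal function. -/
def extremalCoeff (n : ℕ) : ℝ := if n = 0 then 0 else 2 / 3 + 1 / (3 * (n : ℝ) ^ 2)

/-- Comparing coefficients in (z(zf')')' = p · (zg')', the coefficient of zⁿ on the left is (n +
1)³aₙ₊₁. On the right the convex coefficient bound and Carathéodory's bound give 2·(1² + ⋯ + n²) +
(n + 1)². -/
theorem IsC3Pair.norm_taylorCoeff_le {f g : ℂ → ℂ} (h : IsC3Pair f g) (n : ℕ) :
    ‖taylorCoeff f n‖ ≤ extremalCoeff n := by
  rcases n with _ | n
  · simp [extremalCoeff, taylorCoeff_zero, h.map_zero]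
  have hb := h.norm_deriv_pos
  have h1 : taylorCoeff (deriv (zDeriv (zDeriv f))) n =
      taylorCoeff (fun z => IsC3Pair.quot f g z * deriv (zDeriv g) z) n :=
    taylorCoeff_congr (fun z hz => (div_mul_cancel₀ _ (h.deriv_zDeriv_ne_zero hz)).symm) n
  rw [taylorCoeff_mul h.differentiableOn_quot (h.analytic_g.deriv isOpen_disc),
    Finset.sum_range_succ, taylorCoeff_deriv, taylorCoeff_zDeriv h.analytic_one,
    taylorCoeff_zDeriv h.analytic, Nat.sub_self, taylorCoeff_zero, h.quot_zero] at h1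
  simp only [taylorCoeff_deriv, taylorCoeff_zDeriv h.convex.analytic] at h1
  have hn1 : ∀ i : ℕ, ‖(i : ℂ) + 1‖ = i + 1 := fun i => by
    rw [← Nat.cast_succ, norm_natCast]; push_cast; ring
  -- The argument of g'(0) does no harm here: p(0) = 1/g'(0), so Re p(0)·|g'(0)| is a cosine, while
  -- |p(0)||g'(0)| = 1 handles the last term.
  have hre : (IsC3Pair.quot f g 0).re * ‖deriv g 0‖ ≤ 1 := by
    rw [h.quot_zero_re, div_mul_cancel₀ _ hb.ne']; exact h.cosArg_le_one
  have hcoef : ∀ i : ℕ, ‖((i : ℂ) + 1) * (((i + 1 : ℕ) : ℂ) * taylorCoeff g (i + 1))‖ ≤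
      (i + 1 : ℝ) ^ 2 * ‖deriv g 0‖ := by
    intro i
    rw [norm_mul, norm_mul, hn1, norm_natCast, sq, mul_assoc]
    push_cast
    have := h.convex.norm_taylorCoeff_le i
    gcongr
  have h3 : ‖taylorCoeff (deriv (zDeriv (zDeriv f))) n‖ ≤
      ∑ i ∈ Finset.range n, 2 * (i + 1 : ℝ) ^ 2 + (n + 1 : ℝ) ^ 2 := by
    rw [taylorCoeff_deriv, taylorCoeff_zDeriv h.analytic_one, taylorCoeff_zDeriv h.analytic, h1]
    refine (norm_add_le _ _).trans (add_le_add ((norm_sum_le _ _).trans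
      (Finset.sum_le_sum fun i hi => ?_)) ?_)
    · have hin := Finset.mem_range.1 hi
      have h4 := norm_taylorCoeff_le_of_re_pos h.differentiableOn_quot h.re_pos (n := n - i)
        (by omega)
      rw [norm_mul]
      refine (mul_le_mul h4 (hcoef i) (norm_nonneg _) ?_).trans ?_
      · exact mul_nonneg zero_le_two (h.re_pos 0 zero_mem_disc).le
      · have h5 := mul_le_mul_of_nonneg_left hre (by positivity : 0 ≤ 2 * (i + 1 : ℝ) ^ 2)
        linarith
    · rw [norm_mul, norm_inv]
      refine (mul_le_mul_of_nonneg_left (hcoef n) (by positivity)).trans (le_of_eq ?_)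
      field_simp
  have h6 : ∀ m : ℕ, ∑ i ∈ Finset.range m, 2 * (i + 1 : ℝ) ^ 2 =
      (m * (m + 1) * (2 * m + 1) / 3 : ℝ) := by
    intro m
    induction m with
    | zero => simp
    | succ m ihm => rw [Finset.sum_range_succ, ihm]; push_cast; ring
  rw [h6, taylorCoeff_deriv, taylorCoeff_zDeriv h.analytic_one, taylorCoeff_zDeriv h.analytic,
    norm_mul, norm_mul, norm_mul, hn1, norm_natCast] at h3
  rw [extremalCoeff, if_neg n.succ_ne_zero]
  push_cast at h3 ⊢
  refine le_of_mul_le_mul_left (h3.trans (le_of_eq ?_) |>.trans' (le_of_eq ?_))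
    (by positivity : (0 : ℝ) < (n + 1) ^ 3)
  · field_simp
    ring
  · ring

/-! ### The dilogarithm -/

/-- The dilogarithm `∑ zⁿ / n²`. -/
def dilog (z : ℂ) : ℂ := ∑' n : ℕ, z ^ n / (n : ℂ) ^ 2

theorem summable_one_div_sq : Summable fun n : ℕ => 1 / (n : ℝ) ^ 2 :=
  hasSum_zeta_two.summable

theorem norm_dilog_term_le {z : ℂ} (hz : ‖z‖ ≤ 1) (n : ℕ) :
    ‖z ^ n / (n : ℂ) ^ 2‖ ≤ 1 / (n : ℝ) ^ 2 := by
  rw [norm_div, norm_pow, norm_pow, norm_natCast]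
  exact div_le_div_of_nonneg_right (pow_le_one₀ (norm_nonneg _) hz) (by positivity)

theorem hasSum_dilog {z : ℂ} (hz : ‖z‖ ≤ 1) :
    HasSum (fun n : ℕ => z ^ n / (n : ℂ) ^ 2) (dilog z) :=
  (Summable.of_norm_bounded summable_one_div_sq (norm_dilog_term_le hz)).hasSum

theorem continuousOn_dilog : ContinuousOn dilog (closedBall 0 1) := by
  refine continuousOn_tsum (u := fun n : ℕ => 1 / (n : ℝ) ^ 2) (fun n => ?_) summable_one_div_sq
    fun n z hz => norm_dilog_term_le (by simpa using hz) n
  exact ((continuous_pow n).div_const _).continuousOn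

theorem differentiableOn_dilog : DifferentiableOn ℂ dilog disc :=
  differentiableOn_tsum_of_summable_norm summable_one_div_sq
    (fun n => ((differentiable_pow n).div_const _).differentiableOn) isOpen_disc
    fun n _ hz => norm_dilog_term_le (mem_disc.1 hz).le n

theorem dilog_zero : dilog 0 = 0 := by
  have h := hasSum_dilog (z := 0) (by simp)
  refine h.unique ?_
  -- The term n = 0 is 1/0, which is 0 by convention.
  refine hasSum_zero.congr_fun fun n => ?_
  rcases n with _ | n <;> simp

theorem zDeriv_dilog {z : ℂ} (hz : z ∈ disc) : zDeriv dilog z = -log (1 - z) := by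
  have h1 := hasSum_deriv_of_summable_norm (F := fun (n : ℕ) (z : ℂ) => z ^ n / (n : ℂ) ^ 2)
    summable_one_div_sq
    (fun n => ((differentiable_pow n).div_const _).differentiableOn) isOpen_disc
    (fun n _ hz => norm_dilog_term_le (mem_disc.1 hz).le n) hz
  have h2 := hasSum_taylorSeries_neg_log (mem_disc.1 hz)
  refine (h1.mul_left z).unique (h2.congr_fun fun n => ?_)
  have h3 : deriv (fun z : ℂ => z ^ n / (n : ℂ) ^ 2) z = n * z ^ (n - 1) / (n : ℂ) ^ 2 := by
    rw [deriv_div_const, deriv_pow_field]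
  rw [h3]
  rcases n with _ | n
  · simp
  · have : ((n + 1 : ℕ) : ℂ) ≠ 0 := by exact_mod_cast n.succ_ne_zero
    rw [Nat.add_sub_cancel]
    field_simp
    ring

theorem one_sub_mem_slitPlane {z : ℂ} (hz : z ∈ disc) : 1 - z ∈ slitPlane := by
  left
  have := (re_le_norm z).trans_lt (mem_disc.1 hz)
  simpa using this

theorem hasDerivAt_dilog_curve (z : ℂ) {t : ℝ} (ht : (t : ℂ) * z ∈ disc) :
    HasDerivAt (fun t : ℝ => dilog (t * z)) (z * deriv dilog (t * z)) t := by
  have h1 := (differentiableOn_dilog.differentiableAt (disc_mem_nhds ht)).hasDerivAt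
  have h2 : HasDerivAt (fun t : ℝ => (t : ℂ) * z) z t := by
    simpa using (hasDerivAt_id t).ofReal_comp.mul_const z
  have h3 := HasDerivAt.comp (h₂ := dilog) t h1 h2
  rwa [mul_comm] at h3

theorem integral_log_div_eq {z : ℂ} {r : ℝ} (hr : 0 ≤ r) (hrz : ∀ t ∈ Icc 0 r, (t : ℂ) * z ∈ disc) :
    ∫ t in (0 : ℝ)..r, log (1 - (t : ℂ) * z) / (t : ℂ) = -dilog (r * z) := by
  have hu : uIcc 0 r = Icc 0 r := uIcc_of_le hr
  have hcont : ContinuousOn (fun t : ℝ => z * deriv dilog (t * z)) (uIcc 0 r) := by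
    rw [hu]
    refine continuousOn_const.mul ?_
    refine ((differentiableOn_dilog.deriv isOpen_disc).continuousOn).comp (by fun_prop) hrz
  have h1 := intervalIntegral.integral_eq_sub_of_hasDerivAt (a := 0) (b := r)
    (f := fun t : ℝ => dilog (t * z)) (f' := fun t : ℝ => z * deriv dilog (t * z))
    (fun t ht => hasDerivAt_dilog_curve z (hrz t (by rwa [hu] at ht))) hcont.intervalIntegrable
  simp only [ofReal_zero, zero_mul, dilog_zero, sub_zero] at h1
  rw [← h1, ← intervalIntegral.integral_neg]
  -- Only t in (0, r] matters, so the value of the integrand at t = 0, a division by zero, is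
  -- irrelevant.
  refine intervalIntegral.integral_congr_ae (Eventually.of_forall fun t ht => ?_)
  rw [uIoc_of_le hr] at ht
  have h2 := zDeriv_dilog (hrz t ⟨ht.1.le, ht.2⟩)
  rw [zDeriv] at h2
  have h3 : (t : ℂ) ≠ 0 := by exact_mod_cast ht.1.ne'
  rw [div_eq_iff h3]
  linear_combination h2

theorem extremal_eq {z : ℂ} (hz : z ∈ disc) :
    extremal z = 2 * z / (3 * (1 - z)) + 1 / 3 * dilog z := by
  have h := integral_log_div_eq (z := z) (r := 1) zero_le_one fun t ht =>
    mul_mem_disc (by rw [norm_real, Real.norm_of_nonneg ht.1]; exact ht.2) hz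
  rw [extremal, h, ofReal_one, one_mul]
  ring

/-- The alternating sum is twice its even part minus the full sum, and the even part is a quarter of
ζ(2). -/
theorem dilog_neg_one : dilog (-1) = -(Real.pi : ℂ) ^ 2 / 12 := by
  have h1 : HasSum (fun n : ℕ => 1 / (n : ℂ) ^ 2) ((Real.pi : ℂ) ^ 2 / 6) := by
    have := hasSum_ofReal.2 hasSum_zeta_two
    push_cast at this
    exact this
  have h2 : HasSum (fun n : ℕ => if Even n then 1 / (n : ℂ) ^ 2 else 0)
      (1 / 4 * ((Real.pi : ℂ) ^ 2 / 6)) := by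
    have hinj : Function.Injective fun n : ℕ => 2 * n := fun a b h => by simpa using h
    rw [← hinj.hasSum_iff]
    · refine (h1.mul_left (1 / 4)).congr_fun fun n => ?_
      have : Even (2 * n) := even_two_mul n
      simp only [Function.comp, this, if_true]
      push_cast
      rcases eq_or_ne (n : ℂ) 0 with h | h
      · simp [h]
      · field_simp; norm_num
    · intro n hn
      rw [if_neg]
      rintro ⟨k, hk⟩
      exact hn ⟨k, by simp only; omega⟩
  have h3 := (h2.mul_left 2).sub h1
  have h4 := (hasSum_dilog (z := -1) (by simp)).unique (h3.congr_fun fun n => ?_)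
  · rw [h4]; ring
  · by_cases hn : Even n
    · simp only [hn, if_true, hn.neg_one_pow]; ring
    · simp only [hn, if_false, (Nat.not_even_iff_odd.1 hn).neg_one_pow]; ring

/-! ### The covering radius -/

/-- The value `(12 + π²) / 36` of `-f₀(-1)`. -/
def coveringRadius : ℝ := (12 + Real.pi ^ 2) / 36

namespace IsC3Pair

variable {f g : ℂ → ℂ}

theorem norm_deriv_zDeriv_ge (h : IsC3Pair f g) {z : ℂ} (hz : z ∈ disc) (hz0 : z ≠ 0) :
    (3 + ‖z‖ ^ 2) / (3 * (1 + ‖z‖) ^ 3) + defect g * (‖z‖ - 4 * ‖z‖ ^ 3) ≤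
      ‖deriv (zDeriv f) z‖ := by
  have h1 := h.norm_zDeriv_zDeriv_ge_mul hz
  rw [zDeriv, norm_mul] at h1
  exact le_of_mul_le_mul_left h1 (norm_pos_iff.2 hz0)

/-- First integration, valid because zf' is univalent. -/
theorem norm_zDeriv_ge (h : IsC3Pair f g) {z : ℂ} (hz : z ∈ disc) :
    2 * ‖z‖ / (3 * (1 + ‖z‖) ^ 2) + 1 / 3 * Real.log (1 + ‖z‖) +
      defect g * (‖z‖ ^ 2 / 2 - ‖z‖ ^ 4) ≤ ‖zDeriv f z‖ := by
  have hN : ∀ r : ℝ, 0 ≤ r → HasDerivAt (fun r : ℝ => 2 * r / (3 * (1 + r) ^ 2) +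
      1 / 3 * Real.log (1 + r) + defect g * (r ^ 2 / 2 - r ^ 4))
      ((3 + r ^ 2) / (3 * (1 + r) ^ 3) + defect g * (r - 4 * r ^ 3)) r := by
    intro r hr
    have hne : 1 + r ≠ 0 := by positivity
    have hid := hasDerivAt_id' r
    have h1 := hid.const_add 1
    have hA := (hid.const_mul 2).div ((h1.pow 2).const_mul 3)
      (by positivity : 3 * (1 + r) ^ 2 ≠ 0)
    have hL := (h1.log hne).const_mul (1 / 3)
    have hP := (((hid.pow 2).div_const 2).sub (hid.pow 4)).const_mul (defect g)
    refine ((hA.add hL).add hP).congr_deriv ?_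
    simp only [Pi.pow_apply]
    field_simp
    ring
  refine le_norm_of_le_norm_deriv h.analytic_one h.injOn_zDeriv (zDeriv_zero _)
    (M := fun r => (3 + r ^ 2) / (3 * (1 + r) ^ 3) + defect g * (r - 4 * r ^ 3))
    (N := fun r => 2 * r / (3 * (1 + r) ^ 2) +
      1 / 3 * Real.log (1 + r) + defect g * (r ^ 2 / 2 - r ^ 4)) ?_
    (fun z hz hz0 => h.norm_deriv_zDeriv_ge hz hz0) (by simp) (fun r hr _ => hN r hr.le)
    (fun r hr => (hN r hr.1).continuousAt.continuousWithinAt) hz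
  refine ContinuousOn.add (ContinuousOn.div (by fun_prop) (by fun_prop) fun r hr => ?_)
    (by fun_prop)
  have : (0 : ℝ) ≤ r := hr
  positivity

/-- The previous bound divided by |z|. Writing log(1 + r)/r as a `dslope` makes it continuous at 0,
as the next integration requires. -/
theorem norm_deriv_ge (h : IsC3Pair f g) {z : ℂ} (hz : z ∈ disc) (hz0 : z ≠ 0) :
    2 / (3 * (1 + ‖z‖) ^ 2) + 1 / 3 * dslope (fun x : ℝ => Real.log (1 + x)) 0 ‖z‖ +
      defect g * (‖z‖ / 2 - ‖z‖ ^ 3) ≤ ‖deriv f z‖ := by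
  have h1 := h.norm_zDeriv_ge hz
  have hn : 0 < ‖z‖ := norm_pos_iff.2 hz0
  rw [zDeriv, norm_mul] at h1
  refine le_of_mul_le_mul_left (le_trans (le_of_eq ?_) h1) hn
  rw [dslope_of_ne _ hn.ne', slope_def_field]
  simp only [add_zero, Real.log_one, sub_zero]
  field_simp

theorem hasDerivAt_re_dilog_neg {r : ℝ} (hr0 : 0 < r) (hr1 : r < 1) :
    HasDerivAt (fun r : ℝ => -(dilog (-r)).re)
      (dslope (fun x : ℝ => Real.log (1 + x)) 0 r) r := by
  have hmem : (r : ℂ) * (-1) ∈ disc := by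
    rw [mem_disc, norm_mul, norm_neg, norm_one, mul_one, norm_real, Real.norm_of_nonneg hr0.le]
    exact hr1
  have h1 := hasDerivAt_dilog_curve (-1) hmem
  have h2 := (reCLM.hasFDerivAt.comp_hasDerivAt r h1).neg
  have h3 := zDeriv_dilog hmem
  have h4 : -1 * deriv dilog ((r : ℂ) * (-1)) = ((-(Real.log (1 + r) / r) : ℝ) : ℂ) := by
    have hrne : (r : ℂ) ≠ 0 := by exact_mod_cast hr0.ne'
    rw [zDeriv] at h3
    have h5 : (1 : ℂ) - r * (-1) = ((1 + r : ℝ) : ℂ) := by push_cast; ring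
    rw [h5, ← ofReal_log (by linarith)] at h3
    push_cast
    rw [eq_neg_iff_add_eq_zero, ← mul_right_inj' hrne]
    rw [mul_add, mul_div_cancel₀ _ hrne]
    linear_combination h3
  rw [h4] at h2
  have h6 : dslope (fun x : ℝ => Real.log (1 + x)) 0 r = Real.log (1 + r) / r := by
    rw [dslope_of_ne _ hr0.ne', slope_def_field]; simp
  rw [h6]
  have e : (fun r : ℝ => -(dilog (-r)).re) = -(⇑reCLM ∘ fun t : ℝ => dilog ((t : ℂ) * -1)) := by
    funext t; simp
  rw [e]
  refine h2.congr_deriv ?_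
  rw [reCLM_apply, ofReal_re, neg_neg]

theorem continuousOn_re_dilog_neg : ContinuousOn (fun r : ℝ => -(dilog (-r)).re) (Icc 0 1) := by
  refine (continuous_re.comp_continuousOn (continuousOn_dilog.comp (by fun_prop) ?_)).neg
  intro r hr
  rw [mem_closedBall_zero_iff, norm_neg, norm_real, Real.norm_of_nonneg hr.1]
  exact hr.2

/-- Second integration, using the univalence of f. Apart from the defect term the lower bound is
-f₀(-|z|). -/
theorem norm_ge (h : IsC3Pair f g) {z : ℂ} (hz : z ∈ disc) :
    2 * ‖z‖ / (3 * (1 + ‖z‖)) + 1 / 3 * -(dilog (-‖z‖)).re +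
      defect g * (‖z‖ ^ 2 / 4 - ‖z‖ ^ 4 / 4) ≤ ‖f z‖ := by
  refine le_norm_of_le_norm_deriv h.analytic h.injOn h.map_zero
    (M := fun r => 2 / (3 * (1 + r) ^ 2) + 1 / 3 * dslope (fun x : ℝ => Real.log (1 + x)) 0 r +
      defect g * (r / 2 - r ^ 3))
    (N := fun r : ℝ => 2 * r / (3 * (1 + r)) + 1 / 3 * -(dilog (-r)).re +
      defect g * (r ^ 2 / 4 - r ^ 4 / 4)) ?_
    (fun z hz hz0 => h.norm_deriv_ge hz hz0) (by simp [dilog_zero]) (fun r hr0 hr1 => ?_) ?_ hz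
  · have hds : ContinuousOn (dslope (fun x : ℝ => Real.log (1 + x)) 0) (Ici 0) := by
      refine ContinuousOn.mono ?_ (Ici_subset_Ioi.2 (by norm_num : (-1 : ℝ) < 0))
      refine (continuousOn_dslope (Ioi_mem_nhds (by norm_num))).2 ⟨?_, ?_⟩
      · refine ContinuousOn.log (by fun_prop) fun x hx => ?_
        have : (-1 : ℝ) < x := hx
        linarith
      · exact DifferentiableAt.log (by fun_prop) (by norm_num)
    refine ContinuousOn.add (ContinuousOn.add (ContinuousOn.div (by fun_prop) (by fun_prop)
      fun r hr => ?_) (continuousOn_const.mul hds)) (by fun_prop)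
    have : (0 : ℝ) ≤ r := hr
    positivity
  · have hne : 1 + r ≠ 0 := by positivity
    have hid := hasDerivAt_id' r
    have h1 := hid.const_add 1
    have hA := (hid.const_mul 2).div (h1.const_mul 3) (by positivity : 3 * (1 + r) ≠ 0)
    have hL := (hasDerivAt_re_dilog_neg hr0 hr1).const_mul (1 / 3)
    have hP := (((hid.pow 2).div_const 4).sub ((hid.pow 4).div_const 4)).const_mul (defect g)
    refine ((hA.add hL).add hP).congr_deriv ?_
    congr 1
    · congr 1
      field_simp
      ring
    · ring
  · refine ContinuousOn.add (ContinuousOn.add (ContinuousOn.div (by fun_prop) (by fun_prop)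
      fun r hr => ?_) (continuousOn_const.mul (continuousOn_re_dilog_neg.mono Ico_subset_Icc_self)))
      (by fun_prop)
    have : (0 : ℝ) ≤ r := hr.1
    positivity

/-- The error term has the factor r² - r⁴ and disappears in the limit, whatever d is. -/
theorem tendsto_coveringRadius (d : ℝ) :
    Tendsto (fun r : ℝ => 2 * r / (3 * (1 + r)) + 1 / 3 * -(dilog (-r)).re +
      d * (r ^ 2 / 4 - r ^ 4 / 4)) (𝓝[<] 1) (𝓝 coveringRadius) := by
  have h1 : Tendsto (fun r : ℝ => -(dilog (-r)).re) (𝓝[<] 1) (𝓝 (Real.pi ^ 2 / 12)) := by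
    have := (continuousOn_re_dilog_neg 1 (right_mem_Icc.2 zero_le_one)).tendsto
    have h2 : -(dilog (-((1 : ℝ) : ℂ))).re = Real.pi ^ 2 / 12 := by
      rw [ofReal_one, dilog_neg_one]
      have : (-(Real.pi : ℂ) ^ 2 / 12) = ((-Real.pi ^ 2 / 12 : ℝ) : ℂ) := by push_cast; ring
      rw [this, ofReal_re]; ring
    rw [h2] at this
    refine this.mono_left (nhdsWithin_le_iff.2 ?_)
    filter_upwards [Ioo_mem_nhdsLT (zero_lt_one (α := ℝ))] with r hr
    exact Ioo_subset_Icc_self hr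
  have h2 : Tendsto (fun r : ℝ => 2 * r / (3 * (1 + r))) (𝓝[<] 1) (𝓝 (2 * 1 / (3 * (1 + 1)))) := by
    refine Tendsto.mono_left ?_ nhdsWithin_le_nhds
    exact ContinuousAt.tendsto (x := (1 : ℝ)) (f := fun r : ℝ => 2 * r / (3 * (1 + r)))
      (ContinuousAt.div (by fun_prop) (by fun_prop) (by norm_num))
  have h3 : Tendsto (fun r : ℝ => d * (r ^ 2 / 4 - r ^ 4 / 4)) (𝓝[<] 1)
      (𝓝 (d * (1 ^ 2 / 4 - 1 ^ 4 / 4))) := by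
    refine Tendsto.mono_left ?_ nhdsWithin_le_nhds
    exact Continuous.tendsto (by fun_prop) 1
  have h4 := (h2.add (h1.const_mul (1 / 3))).add h3
  convert h4 using 2
  rw [coveringRadius]; ring

/-- A univalent function on the disc is not onto the plane. -/
theorem image_ne_univ {F : ℂ → ℂ} (hF : DifferentiableOn ℂ F disc) (hinj : InjOn F disc) :
    F '' disc ≠ univ := by
  intro h
  have hd : Differentiable ℂ (Function.invFunOn F disc) := by
    intro w
    obtain ⟨z, hz, rfl⟩ : w ∈ F '' disc := by rw [h]; exact mem_univ w
    exact (hasDerivAt_invFunOn isOpen_disc hF hinj hz).differentiableAt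
  have hmem : ∀ w, Function.invFunOn F disc w ∈ disc := fun w =>
    Function.invFunOn_mem (by rw [← mem_image, h]; exact mem_univ w)
  have hb : Bornology.IsBounded (range (Function.invFunOn F disc)) :=
    isBounded_ball.subset (range_subset_iff.2 hmem)
  have h2 : ((1 / 2 : ℝ) : ℂ) ∈ disc := by
    rw [mem_disc, norm_real, Real.norm_of_nonneg] <;> norm_num
  have h3 := hd.apply_eq_apply_of_bounded hb (F ((1 / 2 : ℝ) : ℂ)) (F 0)
  rw [hinj.leftInvOn_invFunOn h2, hinj.leftInvOn_invFunOn zero_mem_disc] at h3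
  norm_num at h3

/-- For each r < 1 the image contains the disc whose radius is the growth bound at r. As the image
is open, its frontier avoids all these discs. -/
theorem coveringRadius_le_norm (h : IsC3Pair f g) {w : ℂ} (hw : w ∈ frontier (f '' disc)) :
    coveringRadius ≤ ‖w‖ := by
  refine le_of_tendsto (tendsto_coveringRadius (defect g)) ?_
  filter_upwards [Ioo_mem_nhdsLT (zero_lt_one (α := ℝ))] with r hr
  by_contra hcon
  push Not at hcon
  have hball := ball_subset_image_ball h.analytic h.injOn h.map_zero hr.1 hr.2
    ((norm_nonneg w).trans_lt hcon)
    (fun z hz => by rw [← hz]; exact h.norm_ge (mem_disc.2 (by rw [hz]; exact hr.2)))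
  have hw2 : w ∈ f '' disc :=
    image_mono (ball_subset_closedBall.trans (closedBall_subset_disc hr.2))
      (hball (mem_ball_zero_iff.2 hcon))
  have ho : IsOpen (f '' disc) := isOpen_image_of_injOn h.analytic h.injOn subset_rfl isOpen_disc
  rw [ho.frontier_eq] at hw
  exact hw.2 hw2

/-- `infDist` to the empty set is 0, so the lower bound for the distance needs a frontier point. -/
theorem frontier_nonempty (h : IsC3Pair f g) : (frontier (f '' disc)).Nonempty := by
  rw [nonempty_frontier_iff]
  exact ⟨⟨f 0, 0, zero_mem_disc, rfl⟩, image_ne_univ h.analytic h.injOn⟩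

theorem coveringRadius_le_boundaryDist (h : IsC3Pair f g) :
    coveringRadius ≤ boundaryDist f := by
  rw [boundaryDist, le_infDist h.frontier_nonempty, h.map_zero]
  intro w hw
  rw [dist_zero_left]
  exact h.coveringRadius_le_norm hw

end IsC3Pair

/-! ### The extremal function and its membership in 𝒞₃ -/

theorem one_sub_ne_zero_of_mem_disc {z : ℂ} (hz : z ∈ disc) : 1 - z ≠ 0 :=
  slitPlane_ne_zero (one_sub_mem_slitPlane hz)

/-- The map `z / (1 - z)` of the disc onto the half-plane `Re w > -1/2`. -/
def halfPlaneMap (z : ℂ) : ℂ := z / (1 - z)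

theorem hasDerivAt_halfPlaneMap {z : ℂ} (hz : z ∈ disc) :
    HasDerivAt halfPlaneMap (1 / (1 - z) ^ 2) z := by
  have hne := one_sub_ne_zero_of_mem_disc hz
  refine ((hasDerivAt_id' z).div ((hasDerivAt_id' z).const_sub 1) hne).congr_deriv ?_
  congr 1
  ring

theorem halfPlaneMap_image : halfPlaneMap '' disc = {w : ℂ | -1 / 2 < w.re} := by
  ext w
  have key : ∀ z : ℂ, normSq (1 + z) = normSq z + 2 * z.re + 1 := fun z => by
    simp [normSq_apply]; ring
  constructor
  · rintro ⟨z, hz, rfl⟩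
    have hne := one_sub_ne_zero_of_mem_disc hz
    have h1 : halfPlaneMap z = z * (1 + halfPlaneMap z) := by
      rw [halfPlaneMap]; field_simp; ring
    have h2 : 1 + halfPlaneMap z ≠ 0 := by
      have : 1 + halfPlaneMap z = 1 / (1 - z) := by rw [halfPlaneMap]; field_simp; ring
      rw [this]
      exact one_div_ne_zero hne
    have h3 : ‖halfPlaneMap z‖ < ‖1 + halfPlaneMap z‖ := by
      calc ‖halfPlaneMap z‖ = ‖z‖ * ‖1 + halfPlaneMap z‖ := by rw [← norm_mul, ← h1]
        _ < 1 * ‖1 + halfPlaneMap z‖ :=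
          mul_lt_mul_of_pos_right (mem_disc.1 hz) (norm_pos_iff.2 h2)
        _ = _ := one_mul _
    have h4 := pow_lt_pow_left₀ h3 (norm_nonneg _) two_ne_zero
    rw [← normSq_eq_norm_sq, ← normSq_eq_norm_sq, key] at h4
    change -1 / 2 < (halfPlaneMap z).re
    linarith
  · intro hw
    have hw : -1 / 2 < w.re := hw
    have h2 : 1 + w ≠ 0 := by
      intro h
      have := congrArg re h
      simp only [add_re, one_re, zero_re] at this
      linarith
    refine ⟨w / (1 + w), ?_, ?_⟩
    · rw [mem_disc, norm_div, div_lt_one (norm_pos_iff.2 h2)]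
      refine lt_of_pow_lt_pow_left₀ 2 (norm_nonneg _) ?_
      rw [← normSq_eq_norm_sq, ← normSq_eq_norm_sq, key]
      linarith
    · have : 1 - w / (1 + w) = 1 / (1 + w) := by field_simp; ring
      rw [halfPlaneMap, this]
      field_simp

theorem isConvexFunction_halfPlaneMap : IsConvexFunction halfPlaneMap where
  analytic z hz := (hasDerivAt_halfPlaneMap hz).differentiableAt.differentiableWithinAt
  univalent z hz w hw h := by
    rw [halfPlaneMap, halfPlaneMap, div_eq_div_iff (one_sub_ne_zero_of_mem_disc hz)
      (one_sub_ne_zero_of_mem_disc hw)] at h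
    linear_combination h
  convex_image := by
    rw [halfPlaneMap_image]
    exact convex_halfSpace_re_gt _
  map_zero := by simp [halfPlaneMap]
  re_deriv_zero_pos := by rw [(hasDerivAt_halfPlaneMap zero_mem_disc).deriv]; simp

theorem deriv_zDeriv_halfPlaneMap {z : ℂ} (hz : z ∈ disc) :
    deriv (zDeriv halfPlaneMap) z = (1 + z) / (1 - z) ^ 3 := by
  have h1 : EqOn (zDeriv halfPlaneMap) (fun z => z / (1 - z) ^ 2) disc := fun w hw => by
    rw [zDeriv, (hasDerivAt_halfPlaneMap hw).deriv, mul_one_div]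
  rw [(h1.eventuallyEq_of_mem (disc_mem_nhds hz)).deriv_eq]
  have hne := one_sub_ne_zero_of_mem_disc hz
  have h2 := (hasDerivAt_id' z).div (((hasDerivAt_id' z).const_sub 1).pow 2) (pow_ne_zero 2 hne)
  refine (h2.congr_deriv ?_).deriv
  simp only [Pi.pow_apply]
  field_simp
  ring

theorem hasDerivAt_extremal {z : ℂ} (hz : z ∈ disc) :
    HasDerivAt extremal (2 / (3 * (1 - z) ^ 2) + 1 / 3 * deriv dilog z) z := by
  have hne := one_sub_ne_zero_of_mem_disc hz
  have hid := hasDerivAt_id' z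
  have h1 := (hid.const_mul 2).div ((hid.const_sub 1).const_mul 3)
    (mul_ne_zero three_ne_zero hne)
  have h2 := ((differentiableOn_dilog.differentiableAt (disc_mem_nhds hz)).hasDerivAt).const_mul
    (1 / 3 : ℂ)
  have h3 : EqOn extremal (fun z => 2 * z / (3 * (1 - z)) + 1 / 3 * dilog z) disc :=
    fun w hw => extremal_eq hw
  refine ((h1.add h2).congr_of_eventuallyEq
    (h3.eventuallyEq_of_mem (disc_mem_nhds hz))).congr_deriv ?_
  congr 1
  field_simp
  ring

theorem zDeriv_extremal {z : ℂ} (hz : z ∈ disc) :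
    zDeriv extremal z = 2 * z / (3 * (1 - z) ^ 2) - 1 / 3 * log (1 - z) := by
  have h := zDeriv_dilog hz
  rw [zDeriv] at h
  rw [zDeriv, (hasDerivAt_extremal hz).deriv]
  linear_combination 1 / 3 * h

theorem zDeriv_zDeriv_extremal {z : ℂ} (hz : z ∈ disc) :
    zDeriv (zDeriv extremal) z = z * (3 + z ^ 2) / (3 * (1 - z) ^ 3) := by
  have hne := one_sub_ne_zero_of_mem_disc hz
  have hid := hasDerivAt_id' z
  have h1 : EqOn (zDeriv extremal) (fun z => 2 * z / (3 * (1 - z) ^ 2) - 1 / 3 * log (1 - z))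
    disc := fun w hw => zDeriv_extremal hw
  have h2 := (hid.const_mul 2).div (((hid.const_sub 1).pow 2).const_mul 3)
    (mul_ne_zero three_ne_zero (pow_ne_zero 2 hne))
  have h3 := ((hid.const_sub 1).clog (one_sub_mem_slitPlane hz)).const_mul (1 / 3)
  rw [zDeriv, (h1.eventuallyEq_of_mem (disc_mem_nhds hz)).deriv_eq]
  have h4 := (h2.sub h3).deriv
  refine (congrArg (z * ·) h4).trans ?_
  simp only [Pi.pow_apply]
  field_simp
  ring

theorem deriv_zDeriv_zDeriv_extremal {z : ℂ} (hz : z ∈ disc) :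
    deriv (zDeriv (zDeriv extremal)) z = (1 + z) ^ 2 / (1 - z) ^ 4 := by
  have hne := one_sub_ne_zero_of_mem_disc hz
  have hid := hasDerivAt_id' z
  have h1 : EqOn (zDeriv (zDeriv extremal)) (fun z => z * (3 + z ^ 2) / (3 * (1 - z) ^ 3)) disc :=
    fun w hw => zDeriv_zDeriv_extremal hw
  rw [(h1.eventuallyEq_of_mem (disc_mem_nhds hz)).deriv_eq]
  have h2 := (hid.mul ((hid.pow 2).const_add 3)).div (((hid.const_sub 1).pow 3).const_mul 3)
    (mul_ne_zero three_ne_zero (pow_ne_zero 3 hne))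
  refine (h2.congr_deriv ?_).deriv
  simp only [Pi.pow_apply, Pi.mul_apply]
  field_simp
  ring

theorem extremal_zero : extremal 0 = 0 := by
  rw [extremal_eq zero_mem_disc, dilog_zero]; simp

/-- The Taylor expansion of the extremal function. -/
theorem hasSum_extremal {z : ℂ} (hz : z ∈ disc) :
    HasSum (fun n => (extremalCoeff n : ℂ) * z ^ n) (extremal z) := by
  have h1 := (hasSum_geometric_of_norm_lt_one (mem_disc.1 hz)).mul_left (2 / 3 * z)
  have h2 : HasSum (fun n : ℕ => if n = 0 then 0 else 2 / 3 * z ^ n) (2 / 3 * z * (1 - z)⁻¹) := by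
    rw [← hasSum_nat_add_iff' 1]
    simp only [Finset.range_one, Finset.sum_singleton, if_true, sub_zero]
    refine h1.congr_fun fun n => ?_
    rw [if_neg n.succ_ne_zero]; ring
  have h3 := h2.add ((hasSum_dilog (mem_disc.1 hz).le).mul_left (1 / 3))
  have hne := one_sub_ne_zero_of_mem_disc hz
  have e : extremal z = 2 / 3 * z * (1 - z)⁻¹ + 1 / 3 * dilog z := by
    rw [extremal_eq hz]; field_simp
  rw [e]
  refine h3.congr_fun fun n => ?_
  rcases n with _ | n
  · simp [extremalCoeff]
  · have : ((n + 1 : ℕ) : ℂ) ≠ 0 := by exact_mod_cast n.succ_ne_zero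
    rw [extremalCoeff, if_neg n.succ_ne_zero, if_neg n.succ_ne_zero]
    push_cast at this ⊢
    field_simp

theorem taylorCoeff_extremal (n : ℕ) : taylorCoeff extremal n = extremalCoeff n :=
  taylorCoeff_eq_of_hasSum (fun _ hz => hasSum_extremal hz) n

theorem deriv_extremal_zero : deriv extremal 0 = 1 := by
  rw [← taylorCoeff_one, taylorCoeff_extremal, extremalCoeff]; norm_num

theorem isC3Pair_extremal : IsC3Pair extremal halfPlaneMap where
  analytic z hz := (hasDerivAt_extremal hz).differentiableAt.differentiableWithinAt
  map_zero := extremal_zero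
  deriv_zero := deriv_extremal_zero
  convex := isConvexFunction_halfPlaneMap
  re_pos z hz := by
    have hne := one_sub_ne_zero_of_mem_disc hz
    have hne' : 1 + z ≠ 0 := by
      have := one_sub_ne_zero_of_mem_disc (z := -z) (by rwa [mem_disc, norm_neg, ← mem_disc])
      rwa [sub_neg_eq_add] at this
    rw [deriv_zDeriv_zDeriv_extremal hz, deriv_zDeriv_halfPlaneMap hz]
    -- The defining quotient of f₀ is (1 + z)/(1 - z), whose real part is positive because z/(1 - z)
    -- has real part above -1/2.
    have e : (1 + z) ^ 2 / (1 - z) ^ 4 / ((1 + z) / (1 - z) ^ 3) = 1 + 2 * halfPlaneMap z := by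
      rw [halfPlaneMap]; field_simp; ring
    have h1 : -1 / 2 < (halfPlaneMap z).re :=
      halfPlaneMap_image.subset (mem_image_of_mem _ hz)
    rw [e]
    simp only [add_re, one_re, mul_re, re_ofNat, im_ofNat, zero_mul, sub_zero]
    linarith

theorem extremalCoeff_nonneg (n : ℕ) : 0 ≤ extremalCoeff n := by
  rw [extremalCoeff]; split_ifs <;> positivity

theorem extremalCoeff_pos {n : ℕ} (hn : n ≠ 0) : 0 < extremalCoeff n := by
  rw [extremalCoeff, if_neg hn]; positivity

theorem extremalCoeff_le_one (n : ℕ) : extremalCoeff n ≤ 1 := by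
  rw [extremalCoeff]
  split_ifs with h
  · exact zero_le_one
  · have h1 : (1 : ℝ) ≤ (n : ℝ) := by exact_mod_cast Nat.one_le_iff_ne_zero.2 h
    have h2 : 1 / (3 * (n : ℝ) ^ 2) ≤ 1 / 3 :=
      one_div_le_one_div_of_le (by norm_num) (by nlinarith)
    linarith

/-! ### The radius equation -/

/-- The tail, from degree `N` on, of the series of the extremal function. -/
def extremalTail (N : ℕ) (r : ℝ) : ℝ := ∑' k : ℕ, extremalCoeff (N + k) * r ^ (N + k)

theorem norm_extremalTail_term_le (N : ℕ) {r s : ℝ} (hr : 0 ≤ r) (hrs : r ≤ s) (k : ℕ) :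
    ‖extremalCoeff (N + k) * r ^ (N + k)‖ ≤ s ^ (N + k) := by
  rw [Real.norm_of_nonneg (mul_nonneg (extremalCoeff_nonneg _) (pow_nonneg hr _))]
  exact (mul_le_of_le_one_left (pow_nonneg hr _) (extremalCoeff_le_one _)).trans
    (pow_le_pow_left₀ hr hrs _)

theorem hasSum_geometric_tail (N : ℕ) {r : ℝ} (hr0 : 0 ≤ r) (hr1 : r < 1) :
    HasSum (fun k : ℕ => r ^ (N + k)) (r ^ N * (1 - r)⁻¹) :=
  ((hasSum_geometric_of_lt_one hr0 hr1).mul_left _).congr_fun fun k => pow_add r N k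

theorem summable_extremalTail (N : ℕ) {r : ℝ} (hr0 : 0 ≤ r) (hr1 : r < 1) :
    Summable fun k : ℕ => extremalCoeff (N + k) * r ^ (N + k) :=
  Summable.of_norm_bounded (hasSum_geometric_tail N hr0 hr1).summable
    (norm_extremalTail_term_le N hr0 le_rfl)

theorem extremalTail_nonneg (N : ℕ) {r : ℝ} (hr0 : 0 ≤ r) : 0 ≤ extremalTail N r :=
  tsum_nonneg fun _ => mul_nonneg (extremalCoeff_nonneg _) (pow_nonneg hr0 _)

theorem extremalTail_term_le (N : ℕ) {r s : ℝ} (hr0 : 0 ≤ r) (hrs : r ≤ s) (k : ℕ) :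
    extremalCoeff (N + k) * r ^ (N + k) ≤ extremalCoeff (N + k) * s ^ (N + k) :=
  mul_le_mul_of_nonneg_left (pow_le_pow_left₀ hr0 hrs _) (extremalCoeff_nonneg _)

theorem monotoneOn_extremalTail (N : ℕ) : MonotoneOn (extremalTail N) (Ico 0 1) :=
  fun _ hr _ hs hrs => (summable_extremalTail N hr.1 hr.2).tsum_le_tsum
    (extremalTail_term_le N hr.1 hrs) (summable_extremalTail N hs.1 hs.2)

theorem strictMonoOn_extremalTail {N : ℕ} (hN : 1 ≤ N) :
    StrictMonoOn (extremalTail N) (Ico 0 1) := fun r hr s hs hrs => by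
  refine Summable.tsum_lt_tsum (i := 0) (extremalTail_term_le N hr.1 hrs.le) ?_
    (summable_extremalTail N hr.1 hr.2) (summable_extremalTail N hs.1 hs.2)
  have hN' : N ≠ 0 := Nat.one_le_iff_ne_zero.1 hN
  exact mul_lt_mul_of_pos_left (pow_lt_pow_left₀ hrs hr.1 hN') (extremalCoeff_pos hN')

theorem continuousOn_extremalTail (N : ℕ) : ContinuousOn (extremalTail N) (Icc 0 (1 / 2)) :=
  continuousOn_tsum (fun k => (continuous_const.mul (continuous_pow (N + k))).continuousOn)
    (hasSum_geometric_tail N (by norm_num : (0 : ℝ) ≤ 1 / 2) (by norm_num)).summable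
    fun k _ hr => norm_extremalTail_term_le N hr.1 hr.2 k

theorem ofReal_mem_disc {r : ℝ} (hr0 : 0 ≤ r) (hr1 : r < 1) : (r : ℂ) ∈ disc := by
  rwa [mem_disc, norm_real, Real.norm_of_nonneg hr0]

theorem extremal_ofReal {r : ℝ} (hr0 : 0 ≤ r) (hr1 : r < 1) :
    extremal r = extremalTail 0 r := by
  have h1 := hasSum_ofReal.2 (summable_extremalTail 0 hr0 hr1).hasSum
  refine (hasSum_extremal (ofReal_mem_disc hr0 hr1)).unique (h1.congr_fun fun n => ?_)
  push_cast
  rw [zero_add]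

theorem ofReal_integral_log_div {r : ℝ} (hr0 : 0 ≤ r) (hr1 : r < 1) :
    ((∫ t in (0 : ℝ)..r, Real.log (1 - t) / t : ℝ) : ℂ) = -dilog r := by
  have hmem : ∀ t ∈ Icc 0 r, (t : ℂ) * 1 ∈ disc := fun t ht => by
    rw [mul_one]; exact ofReal_mem_disc ht.1 (ht.2.trans_lt hr1)
  have h := integral_log_div_eq hr0 hmem
  rw [mul_one] at h
  rw [← h, ← intervalIntegral.integral_ofReal]
  refine intervalIntegral.integral_congr fun t ht => ?_
  rw [uIcc_of_le hr0] at ht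
  have h1 : 0 ≤ 1 - t := by linarith [ht.2]
  rw [ofReal_div, ofReal_log h1]
  push_cast
  rw [mul_one]

theorem extremalTail_zero_eq {r : ℝ} (hr0 : 0 ≤ r) (hr1 : r < 1) :
    2 * r / (3 * (1 - r)) - 1 / 3 * ∫ t in (0 : ℝ)..r, Real.log (1 - t) / t =
      extremalTail 0 r := by
  apply ofReal_injective
  rw [← extremal_ofReal hr0 hr1, extremal_eq (ofReal_mem_disc hr0 hr1), ofReal_sub, ofReal_mul,
    ofReal_integral_log_div hr0 hr1]
  push_cast
  ring

theorem extremalTail_eq {N : ℕ} (hN : 1 ≤ N) {r : ℝ} (hr0 : 0 ≤ r) (hr1 : r < 1) :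
    extremalTail N r = ∑' k : ℕ, r ^ (N + k) / (3 * ((N + k : ℕ) : ℝ) ^ 2) +
      2 / 3 * (r ^ N * (1 - r)⁻¹) := by
  have h1 := (hasSum_geometric_tail N hr0 hr1).mul_left (2 / 3)
  have e : ∀ k : ℕ, r ^ (N + k) / (3 * ((N + k : ℕ) : ℝ) ^ 2) =
      extremalCoeff (N + k) * r ^ (N + k) - 2 / 3 * r ^ (N + k) := fun k => by
    rw [extremalCoeff, if_neg (by omega)]; ring
  have h2 := ((summable_extremalTail N hr0 hr1).hasSum.sub h1).congr_fun e
  rw [h2.tsum_eq, extremalTail]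
  ring

/-- The rational summand of the equation is the geometric part (2/3)rᴺ/(1 - r) of the tail minus the
covering radius. -/
theorem radiusEq_eq {N : ℕ} (hN : 1 ≤ N) {r : ℝ} (hr0 : 0 ≤ r) (hr1 : r < 1) :
    radiusEq N r = extremalTail 0 r ^ 2 + extremalTail N r - coveringRadius := by
  have hne : 1 - r ≠ 0 := by linarith
  rw [radiusEq, extremalTail_zero_eq hr0 hr1, extremalTail_eq hN hr0 hr1, coveringRadius]
  field_simp
  ring

theorem strictMonoOn_radiusEq {N : ℕ} (hN : 1 ≤ N) : StrictMonoOn (radiusEq N) (Ico 0 1) := by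
  intro r hr s hs hrs
  rw [radiusEq_eq hN hr.1 hr.2, radiusEq_eq hN hs.1 hs.2]
  have h1 := pow_le_pow_left₀ (extremalTail_nonneg 0 hr.1)
    (monotoneOn_extremalTail 0 hr hs hrs.le) 2
  linarith [strictMonoOn_extremalTail hN hr hs hrs]

theorem continuousOn_radiusEq {N : ℕ} (hN : 1 ≤ N) : ContinuousOn (radiusEq N) (Icc 0 (1 / 2)) := by
  refine ((((continuousOn_extremalTail 0).pow 2).add (continuousOn_extremalTail N)).sub
    (continuousOn_const (c := coveringRadius))).congr fun r hr => ?_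
  exact radiusEq_eq hN hr.1 (hr.2.trans_lt (by norm_num))

theorem radiusEq_zero_neg {N : ℕ} (hN : 1 ≤ N) : radiusEq N 0 < 0 := by
  have h : ∀ M, extremalTail M 0 = 0 := fun M => by
    rw [extremalTail]
    refine (tsum_congr fun k => ?_).trans tsum_zero
    rcases eq_or_ne (M + k) 0 with h | h
    · simp [h, extremalCoeff]
    · rw [zero_pow h, mul_zero]
  rw [radiusEq_eq hN le_rfl zero_lt_one, h 0, h N, coveringRadius]
  have := sq_nonneg Real.pi
  linarith

theorem radiusEq_half_pos {N : ℕ} (hN : 1 ≤ N) : 0 < radiusEq N (1 / 2) := by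
  -- 1/2 + 3/16 from degrees 1 and 2, plus 1/6 from the coefficients beyond, each at least 2/3. The
  -- square of 41/48 already exceeds the covering radius, so the tail is needed only to be
  -- nonnegative.
  have h1 : (41 / 48 : ℝ) ≤ extremalTail 0 (1 / 2) := by
    have hs := summable_extremalTail 0 (by norm_num : (0 : ℝ) ≤ 1 / 2) (by norm_num)
    have h2 := (hasSum_geometric_tail 3 (by norm_num : (0 : ℝ) ≤ 1 / 2) (by norm_num)).mul_left
      (2 / 3)
    rw [extremalTail, ← hs.sum_add_tsum_nat_add 3]
    have h3 : 2 / 3 * ((1 / 2 : ℝ) ^ 3 * (1 - 1 / 2)⁻¹) ≤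
        ∑' i : ℕ, extremalCoeff (0 + (i + 3)) * (1 / 2) ^ (0 + (i + 3)) := by
      rw [← h2.tsum_eq]
      refine h2.summable.tsum_le_tsum (fun k => ?_) ((summable_nat_add_iff 3).2 hs)
      rw [zero_add, add_comm 3 k]
      refine mul_le_mul_of_nonneg_right ?_ (by positivity)
      rw [extremalCoeff, if_neg (by omega)]
      exact le_add_of_nonneg_right (by positivity)
    refine le_trans ?_ (add_le_add_right h3 _)
    simp only [Finset.sum_range_succ, Finset.sum_range_zero, extremalCoeff]
    norm_num
  rw [radiusEq_eq hN (by norm_num) (by norm_num), coveringRadius]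
  have h2 := extremalTail_nonneg N (by norm_num : (0 : ℝ) ≤ 1 / 2)
  have h3 := Real.pi_lt_d2
  have h4 := Real.pi_pos
  nlinarith

theorem exists_root_radiusEq {N : ℕ} (hN : 1 ≤ N) :
    ∃ R ∈ Ioo (0 : ℝ) (1 / 2), radiusEq N R = 0 :=
  intermediate_value_Ioo (by norm_num) (continuousOn_radiusEq hN)
    ⟨radiusEq_zero_neg hN, radiusEq_half_pos hN⟩

/-! ### The inequality, and sharpness for the extremal function -/

theorem IsC3Pair.bohrSum_le {f g : ℂ → ℂ} (h : IsC3Pair f g) {N : ℕ} (hN : 1 ≤ N) {z : ℂ}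
    (hz : z ∈ disc) : bohrSum N f z ≤ radiusEq N ‖z‖ + coveringRadius := by
  have hz1 := mem_disc.1 hz
  have hs : ∀ M, Summable fun k : ℕ => extremalCoeff (M + k) * ‖z‖ ^ (M + k) :=
    fun M => summable_extremalTail M (norm_nonneg z) hz1
  have hle : ∀ M k : ℕ, ‖taylorCoeff f (M + k) * z ^ (M + k)‖ ≤
      extremalCoeff (M + k) * ‖z‖ ^ (M + k) := fun M k => by
    rw [norm_mul, norm_pow]
    exact mul_le_mul_of_nonneg_right (h.norm_taylorCoeff_le _) (by positivity)
  have h1 : ‖f z‖ ≤ extremalTail 0 ‖z‖ := by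
    have h2 : HasSum (fun k => taylorCoeff f (0 + k) * z ^ (0 + k)) (f z) :=
      (hasSum_taylorCoeff h.analytic hz).congr_fun fun k => by rw [zero_add]
    rw [← h2.tsum_eq]
    exact tsum_of_norm_bounded (hs 0).hasSum (hle 0)
  have h3 : ∑' k : ℕ, ‖taylorCoeff f (N + k) * z ^ (N + k)‖ ≤ extremalTail N ‖z‖ :=
    (Summable.of_nonneg_of_le (fun _ => norm_nonneg _) (hle N) (hs N)).tsum_le_tsum (hle N) (hs N)
  rw [radiusEq_eq hN (norm_nonneg z) hz1, bohrSum, sub_add_cancel]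
  exact add_le_add (pow_le_pow_left₀ (norm_nonneg _) h1 2) h3

theorem bohrSum_extremal {N : ℕ} (hN : 1 ≤ N) {r : ℝ} (hr0 : 0 ≤ r) (hr1 : r < 1) :
    bohrSum N extremal r = radiusEq N r + coveringRadius := by
  rw [radiusEq_eq hN hr0 hr1, bohrSum, sub_add_cancel, extremal_ofReal hr0 hr1, norm_real,
    Real.norm_of_nonneg (extremalTail_nonneg 0 hr0)]
  congr 1
  refine tsum_congr fun k => ?_
  rw [taylorCoeff_extremal, norm_mul, norm_pow, norm_real, norm_real, Real.norm_of_nonneg hr0,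
    Real.norm_of_nonneg (extremalCoeff_nonneg _)]

theorem neg_ofReal_mem_disc {r : ℝ} (hr : r ∈ Ioo (0 : ℝ) 1) : -(r : ℂ) ∈ disc := by
  rw [mem_disc, norm_neg, ← mem_disc]
  exact ofReal_mem_disc hr.1.le hr.2

/-- At -r the dilogarithm is real, so -f₀(-r) is the growth bound with zero defect. -/
theorem tendsto_extremal_neg :
    Tendsto (fun r : ℝ => extremal (-(r : ℂ))) (𝓝[<] 1) (𝓝 (-(coveringRadius : ℂ))) := by
  have h1 := (continuous_ofReal.tendsto coveringRadius).comp (IsC3Pair.tendsto_coveringRadius 0)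
  refine h1.neg.congr' ?_
  filter_upwards [Ioo_mem_nhdsLT (zero_lt_one (α := ℝ))] with r hr
  have hm := neg_ofReal_mem_disc hr
  have h2 : dilog (-(r : ℂ)) = ((dilog (-(r : ℂ))).re : ℂ) := by
    have h3 := hasSum_dilog (mem_disc.1 hm).le
    refine h3.unique ((hasSum_ofReal.2 (hasSum_re h3)).congr_fun fun n => ?_)
    have : (-(r : ℂ)) ^ n / (n : ℂ) ^ 2 = (((-r) ^ n / (n : ℝ) ^ 2 : ℝ) : ℂ) := by push_cast; rfl
    rw [this, ofReal_re]
  rw [extremal_eq hm]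
  simp only [Function.comp]
  rw [zero_mul, add_zero]
  push_cast
  rw [← h2, sub_neg_eq_add]
  ring

/-- If the value were attained at z, the open image of a smaller disc containing z would be a
neighbourhood of it, hence contain f₀(-r) for some r beyond that disc. This contradicts injectivity.
-/
theorem neg_coveringRadius_notMem : -(coveringRadius : ℂ) ∉ extremal '' disc := by
  rintro ⟨z, hz, hzc⟩
  have h := isC3Pair_extremal
  obtain ⟨s, hs, hs1⟩ := exists_between (mem_disc.1 hz)
  have hsub : ball (0 : ℂ) s ⊆ disc := ball_subset_ball hs1.le
  have ho : IsOpen (extremal '' ball 0 s) :=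
    isOpen_image_of_injOn h.analytic h.injOn hsub isOpen_ball
  have hmem : extremal '' ball 0 s ∈ 𝓝 (-(coveringRadius : ℂ)) :=
    ho.mem_nhds ⟨z, mem_ball_zero_iff.2 hs, hzc⟩
  have hs0 : 0 ≤ s := (norm_nonneg z).trans hs.le
  obtain ⟨r, ⟨w, hw, hwr⟩, hr⟩ := ((tendsto_extremal_neg.eventually_mem hmem).and
    (Ioo_mem_nhdsLT hs1)).exists
  have hr' : r ∈ Ioo (0 : ℝ) 1 := ⟨hs0.trans_lt hr.1, hr.2⟩
  have e := h.injOn (hsub hw) (neg_ofReal_mem_disc hr') hwr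
  rw [e, mem_ball_zero_iff, norm_neg, norm_real, Real.norm_of_nonneg hr'.1.le] at hw
  exact hw.not_gt hr.1

theorem boundaryDist_extremal : boundaryDist extremal = coveringRadius := by
  refine le_antisymm ?_ isC3Pair_extremal.coveringRadius_le_boundaryDist
  have hcl : -(coveringRadius : ℂ) ∈ closure (extremal '' disc) := by
    refine mem_closure_of_tendsto tendsto_extremal_neg ?_
    filter_upwards [Ioo_mem_nhdsLT (zero_lt_one (α := ℝ))] with r hr
    exact mem_image_of_mem _ (neg_ofReal_mem_disc hr)
  have hfr : -(coveringRadius : ℂ) ∈ frontier (extremal '' disc) :=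
    ⟨hcl, fun h => neg_coveringRadius_notMem (interior_subset h)⟩
  have h0 : 0 ≤ coveringRadius := by rw [coveringRadius]; positivity
  refine (infDist_le_dist_of_mem hfr).trans (le_of_eq ?_)
  rw [extremal_zero, dist_zero_left, norm_neg, norm_real, Real.norm_of_nonneg h0]

end BohrRogosinski

end

theorem mainTheorem12 (N : ℕ) (hN : 1 ≤ N) :
    ∃ R : ℝ,
      -- `R` is the unique root in `(0, 1/2)`
      (R ∈ Set.Ioo (0 : ℝ) (1 / 2) ∧ BohrRogosinski.radiusEq N R = 0 ∧
        ∀ r ∈ Set.Ioo (0 : ℝ) (1 / 2), BohrRogosinski.radiusEq N r = 0 → r = R) ∧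
      -- the inequality for `|z| ≤ R`
      (∀ f : ℂ → ℂ, BohrRogosinski.IsClassC3 f → f 0 = 0 → deriv f 0 = 1 →
        ∀ z : ℂ, ‖z‖ ≤ R → BohrRogosinski.bohrSum N f z ≤ BohrRogosinski.boundaryDist f) ∧
      -- sharpness: equality at `R`, and failure at every larger radius, for the extremal function
      (BohrRogosinski.IsClassC3 BohrRogosinski.extremal ∧
        BohrRogosinski.extremal 0 = 0 ∧ deriv BohrRogosinski.extremal 0 = 1 ∧
        BohrRogosinski.bohrSum N BohrRogosinski.extremal (R : ℂ) =
          BohrRogosinski.boundaryDist BohrRogosinski.extremal ∧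
        ∀ r : ℝ, R < r → r < 1 →
          BohrRogosinski.boundaryDist BohrRogosinski.extremal <
            BohrRogosinski.bohrSum N BohrRogosinski.extremal (r : ℂ)) := by
  obtain ⟨R, hR, hR0⟩ := BohrRogosinski.exists_root_radiusEq hN
  have hR1 : R < 1 := hR.2.trans (by norm_num)
  have hRm : R ∈ Set.Ico (0 : ℝ) 1 := ⟨hR.1.le, hR1⟩
  have hmono := BohrRogosinski.strictMonoOn_radiusEq hN
  have hpair := BohrRogosinski.isC3Pair_extremal
  refine ⟨R, ⟨hR, hR0, fun r hr hr0 => ?_⟩, fun f hf hf0 hf1 z hz => ?_,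
    ⟨hpair.analytic, _, hpair.convex, hpair.re_pos⟩, hpair.map_zero, hpair.deriv_zero, ?_,
    fun r hr hr1 => ?_⟩
  · exact hmono.injOn ⟨hr.1.le, hr.2.trans (by norm_num)⟩ hRm (hr0.trans hR0.symm)
  · obtain ⟨g, hg, hre⟩ := hf.exists_convex
    have h : BohrRogosinski.IsC3Pair f g := ⟨hf.analytic, hf0, hf1, hg, hre⟩
    have hz1 : ‖z‖ < 1 := hz.trans_lt hR1
    have h1 := h.bohrSum_le hN (BohrRogosinski.mem_disc.2 hz1)
    have h2 := hmono.monotoneOn ⟨norm_nonneg z, hz1⟩ hRm hz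
    linarith [h.coveringRadius_le_boundaryDist]
  · rw [BohrRogosinski.boundaryDist_extremal, BohrRogosinski.bohrSum_extremal hN hR.1.le hR1, hR0,
      zero_add]
  · have hr0 : 0 ≤ r := hR.1.le.trans hr.le
    rw [BohrRogosinski.boundaryDist_extremal, BohrRogosinski.bohrSum_extremal hN hr0 hr1]
    linarith [hmono hRm ⟨hr0, hr1⟩ hr]
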